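/- Let $\mathbb{K}=\mathbb{R}$ or $\mathbb{C}$, and let $B_\delta$ be the closed ball of center $0$ and radius $\delta$ in $\mathbb{K}^2$ (Euclidean norm). Let $\mathcal{C}^k_\delta$ be the space of vector fields $f$ with values in $\mathbb{K}^2$ that are $k$ times continuously (real-)differentiable on an open neighborhood of $B_\delta$, with norm $\|f\|_{\mathcal{C}^k}=\sum_j\sum_{|\alpha|\le k}\frac1{\alpha!}\|\partial^\alpha f_j\|_{L^\infty(B_\delta)}$; let $\mathcal{C}^\infty_\delta=\bigcap_k\mathcal{C}^k_\delta$, and let $\mathcal{C}^{\omega,r}_\delta$ be the set of $f\in\mathcal{C}^\infty_\delta$ with $\sum_j\sum_{\alpha}\frac{r^{|\alpha|}}{\alpha!}\|\partial^\alpha f_j\|_{L^\infty(B_\delta)}<\infty$ (the $\alpha$ are multi-indices of real partial derivatives). For vector fields put $[f,g]=(f\cdot\nabla)g-(g\cdot\nabla)f$ and $\mathrm{ad}_f(g)=[f,g]$. Let $\mathcal{L}(X)$ be the free Lie algebra over $\mathbb{K}$ on two indeterminates $X_0,X_1$, realized as the Lie subalgebra generated by $X_0,X_1$ in the free associative algebra,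 and let $\mathcal{B}$ be any basis of $\mathcal{L}(X)$ consisting of (evaluations of) iterated brackets of $X_0,X_1$ and containing $X_0$ and all $\mathrm{ad}_{X_0}^k(X_1)$, $k\ge0$. For a control $u$, the coordinates of the first kind $(\zeta_b(t,u))_{b\in\mathcal{B}}$ are the unique scalars such that, for every formal series $x^\star$ in the non-commuting indeterminates $X_0,X_1$, the solution of the formal differential equation $\dot x(t)=x(t)\,(X_0+u(t)X_1)$, $x(0)=x^\star$, is $x(t)=x^\star\exp\big(\sum_{b\in\mathcal{B}}\zeta_b(t,u)\,b\big)$. **Proposition.** Let $f_0(x)=x_2e_1$, $f_1(x)=\frac{1}{1-x_1}e_2$, $T=1$ and $u(t)=t$, so that $f_0(0)=0$ and $u\in\mathcal{C}^\infty([0,T])$. There exists $\delta>0$ such that $f_0,f_1\in\mathcal{C}^{\omega,\delta}_\delta$ and such that, for every such basis $\mathcal{B}$ and every $t\in(0,T)$, the vector fields $$F_n(t):=\sum_{k=0}^n\zeta_{\mathrm{ad}_{X_0}^k(X_1)}(t,u)\,\mathrm{ad}_{f_0}^k(f_1)$$ belong to $\mathcal{C}^\infty_\delta$ for every $n\in\mathbb{N}$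 and, for every $\delta^*\in(0,\delta)$, the sequence $(F_n(t))_{n\in\mathbb{N}}$ does not converge in $\mathcal{C}^0_{\delta^*}$. -/

import Mathlib

open Filter Topology
open scoped ContDiff

/-! ### Regular and analytic vector fields near the origin of `𝕂^d`, for `𝕂 = ℝ` or `ℂ` -/

/-- The state space `𝕂^d`, with its Euclidean norm. -/
abbrev StateSpace (𝕂 : Type) [RCLike 𝕂] (d : ℕ) : Type := EuclideanSpace 𝕂 (Fin d)

/-- The derivative of `g` in the direction `v`, with respect to the real structure. -/
noncomputable def realDirDeriv {𝕂 : Type} [RCLike 𝕂] {d : ℕ} (v : StateSpace 𝕂 d)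
    (g : StateSpace 𝕂 d → 𝕂) : StateSpace 𝕂 d → 𝕂 :=
  fun x => fderiv ℝ g x v

/-- The real partial derivative `∂^α` of a scalar function on `𝕂^d`. The entry `α (j, 0)` is the
order in the real direction `e_j`, the entry `α (j, 1)` the order in the direction `i e_j`.
For `𝕂 = ℝ` one has `RCLike.I = 0`, so the derivatives with some `α (j, 1) ≠ 0` vanish
and `∂^α` is the usual partial derivative for the multi-index `j ↦ α (j, 0)` otherwise. -/
noncomputable def realPartial {𝕂 : Type} [RCLike 𝕂] {d : ℕ} (α : Fin d × Fin 2 → ℕ)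
    (g : StateSpace 𝕂 d → 𝕂) : StateSpace 𝕂 d → 𝕂 :=
  (List.finRange d).foldr
    (fun j h =>
      (realDirDeriv (EuclideanSpace.single j (1 : 𝕂)))^[α (j, 0)]
        ((realDirDeriv (EuclideanSpace.single j (RCLike.I : 𝕂)))^[α (j, 1)] h))
    g

/-- `‖g‖_{L^∞(B_δ)}` for the closed ball `B_δ` of centre `0` and radius `δ`. -/
noncomputable def supBall {𝕂 : Type} [RCLike 𝕂] {d : ℕ} (δ : ℝ) (g : StateSpace 𝕂 d → 𝕂) :
    ENNReal :=
  ⨆ x ∈ Metric.closedBall (0 : StateSpace 𝕂 d) δ, ‖g x‖ₑ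

/-- The space `C^k_δ` of vector fields that are of class `C^k` (for the real structure) on an open
neighbourhood of `B_δ`. -/
def MemCk {𝕂 : Type} [RCLike 𝕂] {d : ℕ} (k : ℕ) (δ : ℝ)
    (f : StateSpace 𝕂 d → StateSpace 𝕂 d) : Prop :=
  ∃ U : Set (StateSpace 𝕂 d), IsOpen U ∧ Metric.closedBall 0 δ ⊆ U ∧ ContDiffOn ℝ k f U

/-- The space `C^∞_δ`, the intersection of the spaces `C^k_δ`. -/
def MemCinfty {𝕂 : Type} [RCLike 𝕂] {d : ℕ} (δ : ℝ)
    (f : StateSpace 𝕂 d → StateSpace 𝕂 d) : Prop :=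
  ∀ k : ℕ, MemCk k δ f

/-- The norm of `C^k_δ`: `∑_j ∑_{|α| ≤ k} (1/α!) ‖∂^α f_j‖_{L^∞(B_δ)}`. -/
noncomputable def ckNorm {𝕂 : Type} [RCLike 𝕂] {d : ℕ} (k : ℕ) (δ : ℝ)
    (f : StateSpace 𝕂 d → StateSpace 𝕂 d) : ENNReal :=
  ∑ j : Fin d, ∑' α : {α : Fin d × Fin 2 → ℕ // ∑ p, α p ≤ k},
    ENNReal.ofReal (1 / ∏ p, ((α.1 p).factorial : ℝ)) *
      supBall δ (realPartial α.1 (fun x => f x j))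

/-- The analytic norm `∑_j ∑_α (r^{|α|}/α!) ‖∂^α f_j‖_{L^∞(B_δ)}`. -/
noncomputable def analyticNorm {𝕂 : Type} [RCLike 𝕂] {d : ℕ} (r δ : ℝ)
    (f : StateSpace 𝕂 d → StateSpace 𝕂 d) : ENNReal :=
  ∑ j : Fin d, ∑' α : Fin d × Fin 2 → ℕ,
    ENNReal.ofReal (r ^ (∑ p, α p) / ∏ p, ((α p).factorial : ℝ)) *
      supBall δ (realPartial α (fun x => f x j))

/-- The space `C^{ω,r}_δ` of real-analytic vector fields. -/
def MemAnalytic {𝕂 : Type} [RCLike 𝕂] {d : ℕ} (r δ : ℝ)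
    (f : StateSpace 𝕂 d → StateSpace 𝕂 d) : Prop :=
  MemCinfty δ f ∧ analyticNorm r δ f < ⊤

/-- `ad_f^k(g)` for the bracket `[f, g] = (f · ∇) g - (g · ∇) f` of vector fields. -/
noncomputable def adField {𝕂 : Type} [RCLike 𝕂] {d : ℕ} (f g : StateSpace 𝕂 d → StateSpace 𝕂 d)
    (k : ℕ) : StateSpace 𝕂 d → StateSpace 𝕂 d :=
  (fun h => VectorField.lieBracket ℝ f h)^[k] g

/-! ### Formal brackets, the free Lie algebra, formal series -/

section

attribute [local instance] LieRing.ofAssociativeRing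

/-- The evaluation of a formal bracket (an element of the free magma over the indeterminates `X_i`)
in the free associative algebra, endowed with its commutator bracket. -/
noncomputable def evalBracket (𝕂 : Type) [RCLike 𝕂] {I : Type} :
    FreeMagma I → FreeAlgebra 𝕂 I
  | FreeMagma.of i => FreeAlgebra.ι 𝕂 i
  | FreeMagma.mul b₁ b₂ => ⁅evalBracket 𝕂 b₁, evalBracket 𝕂 b₂⁆

/-- The free Lie algebra `L(X)`: the Lie subalgebra generated by the indeterminates in the free
associative algebra. -/
noncomputable def freeLie (𝕂 : Type) [RCLike 𝕂] (I : Type) :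
    LieSubalgebra 𝕂 (FreeAlgebra 𝕂 I) :=
  LieSubalgebra.lieSpan 𝕂 (FreeAlgebra 𝕂 I) (Set.range (FreeAlgebra.ι 𝕂))

/-- `B` is a monomial basis of `L(X)`: a set of formal brackets whose evaluations form a basis of
the vector space `L(X)`. -/
def IsMonomialBasis (𝕂 : Type) [RCLike 𝕂] {I : Type} (B : Set (FreeMagma I)) : Prop :=
  LinearIndependent 𝕂 (fun b : B => evalBracket 𝕂 (b : FreeMagma I)) ∧
    Submodule.span 𝕂 (evalBracket 𝕂 '' B) = (freeLie 𝕂 I).toSubmodule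

end

/-- The formal bracket `ad_{X_0}^k(X_1)`. -/
def adBracket : ℕ → FreeMagma (Fin 2)
  | 0 => FreeMagma.of 1
  | k + 1 => FreeMagma.mul (FreeMagma.of 0) (adBracket k)

/-- Formal series in non-commuting indeterminates, given by their coefficients
`σ ↦ ⟨S, X_σ⟩` on the words `σ`. -/
abbrev FormalSeries (𝕂 I : Type) : Type := List I → 𝕂

/-- The (concatenation) product of formal series. -/
def fsMul {𝕂 I : Type} [RCLike 𝕂] (S S' : FormalSeries 𝕂 I) : FormalSeries 𝕂 I :=
  fun σ => ∑ i ∈ Finset.range (σ.length + 1), S (σ.take i) * S' (σ.drop i)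

/-- The formal series `1`. -/
def fsOne {𝕂 I : Type} [RCLike 𝕂] : FormalSeries 𝕂 I
  | [] => 1
  | _ :: _ => 0

/-- The powers of a formal series. -/
def fsPow {𝕂 I : Type} [RCLike 𝕂] (S : FormalSeries 𝕂 I) : ℕ → FormalSeries 𝕂 I
  | 0 => fsOne
  | m + 1 => fsMul (fsPow S m) S

/-- `exp(S) = ∑_m S^m / m!` for a formal series `S` with zero constant term: on a word `σ`, the
terms with `m > |σ|` do not contribute. -/
noncomputable def fsExp {𝕂 I : Type} [RCLike 𝕂] (S : FormalSeries 𝕂 I) : FormalSeries 𝕂 I :=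
  fun σ => ∑ m ∈ Finset.range (σ.length + 1), ((m.factorial : 𝕂))⁻¹ * fsPow S m σ

/-- The coefficient `⟨p, X_σ⟩` of a non-commutative polynomial `p` on the word `σ`. -/
noncomputable def wordCoeff {𝕂 I : Type} [RCLike 𝕂] (p : FreeAlgebra 𝕂 I) (σ : List I) : 𝕂 :=
  (FreeAlgebra.equivMonoidAlgebraFreeMonoid (R := 𝕂) (X := I) p).coeff (FreeMonoid.ofList σ)

/-- The formal Lie series `∑_{b ∈ B} ζ_b b`. For a monomial basis `B` on finitely many
indeterminates, only finitely many `b` have a non-zero coefficient on a given word. -/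
noncomputable def bracketSeries {𝕂 I : Type} [RCLike 𝕂] (B : Set (FreeMagma I))
    (ζ : FreeMagma I → 𝕂) : FormalSeries 𝕂 I :=
  fun σ => ∑ᶠ b : B, ζ b * wordCoeff (evalBracket 𝕂 (b : FreeMagma I)) σ

/-! ### The formal differential equation and the coordinates of the first kind -/

/-- Auxiliary recursion for `formalSolution`, on the reversed word. -/
noncomputable def formalSolutionRev {𝕂 I : Type} [RCLike 𝕂] (xs : FormalSeries 𝕂 I)
    (a : I → ℝ → 𝕂) : List I → ℝ → 𝕂
  | [] => fun _ => xs []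
  | i :: ρ => fun t =>
      xs (i :: ρ).reverse + ∫ τ in (0 : ℝ)..t, formalSolutionRev xs a ρ τ * a i τ

/-- The solution of the formal differential equation `x' = x (∑_i a_i X_i)`, `x(0) = xs`, that is
`⟨x(t), 1⟩ = ⟨xs, 1⟩` and
`⟨x(t), X_σ X_i⟩ = ⟨xs, X_σ X_i⟩ + ∫_0^t ⟨x(τ), X_σ⟩ a_i(τ) dτ`. -/
noncomputable def formalSolution {𝕂 I : Type} [RCLike 𝕂] (xs : FormalSeries 𝕂 I)
    (a : I → ℝ → 𝕂) (t : ℝ) : FormalSeries 𝕂 I :=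
  fun σ => formalSolutionRev xs a σ.reverse t

/-- The scalars `(ζ_b)_{b ∈ B}` satisfy `x(t) = xs exp(∑_{b ∈ B} ζ_b b)` for every initial datum
`xs`, where `x` is the solution of the formal differential equation driven by `a`. -/
def IsFirstKindAt {𝕂 I : Type} [RCLike 𝕂] (B : Set (FreeMagma I)) (a : I → ℝ → 𝕂) (t : ℝ)
    (ζ : FreeMagma I → 𝕂) : Prop :=
  ∀ xs : FormalSeries 𝕂 I,
    formalSolution xs a t = fsMul xs (fsExp (bracketSeries B ζ))

open Classical in
/-- The coordinates of the first kind `ζ_b(t, a)`, `b ∈ B`, associated with a monomial basis `B`: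
the (unique) scalars with `x(t) = xs exp(∑_{b ∈ B} ζ_b(t, a) b)`.
Only the values at `b ∈ B` are meaningful. -/
noncomputable def firstKindCoord {𝕂 I : Type} [RCLike 𝕂] (B : Set (FreeMagma I))
    (a : I → ℝ → 𝕂) (t : ℝ) : FreeMagma I → 𝕂 :=
  if h : ∃ ζ : FreeMagma I → 𝕂, IsFirstKindAt B a t ζ then h.choose else 0

/-- The inputs `a_0 = 1`, `a_1 = u` of the scalar-input control-affine system
`x' = x (X_0 + u(t) X_1)`. -/
def affineInput {𝕂 : Type} [RCLike 𝕂] (u : ℝ → 𝕂) : Fin 2 → ℝ → 𝕂 :=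
  ![fun _ => 1, u]

/-- The partial sum `F_n(t) = ∑_{k=0}^n ζ_{ad_{X_0}^k(X_1)}(t, u) ad_{f_0}^k(f_1)` of the part of
the Magnus expansion that is linear with respect to the control. -/
noncomputable def magnusLinearSum {𝕂 : Type} [RCLike 𝕂] {d : ℕ} (B : Set (FreeMagma (Fin 2)))
    (f₀ f₁ : StateSpace 𝕂 d → StateSpace 𝕂 d) (u : ℝ → 𝕂) (n : ℕ) (t : ℝ) :
    StateSpace 𝕂 d → StateSpace 𝕂 d :=
  fun x => ∑ k ∈ Finset.range (n + 1),
    firstKindCoord B (affineInput u) t (adBracket k) • adField f₀ f₁ k x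

/-! ### The ring of formal series -/

section SeriesMul

variable {𝕂 I : Type} [RCLike 𝕂]

/-! For `u(t) = t` the coordinate along `ad_{X_0}^k(X_1)` is `t^(k+2) B_{k+1}/(k+1)!`
(`coord_adBracket`), where `B_j` are the Bernoulli numbers. The second component of
`ad_{f_0}^k(f_1)` is `k! x_2^k / (1 - x_1)^(k+1)` (`adField_apply_one`). At the point `(0, δ')` the
k-th term of the series is therefore `k! δ'^k t^(k+2) B_{k+1}/(k+1)!`. Bernoulli numbers of even
index satisfy `|B_{2m}|/(2m)! ≥ (2π)^(-2m)`, so the factorial wins over every geometric factor and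
the terms do not tend to 0, however small `δ'` and `t` are.

The coordinates are found by comparing coefficients on the words `0^n 1`. On such a word the
logarithm sees only `ad_{X_0}^n(X_1)` (`bracketSeries_zerosOne`), and its exponential gives a
triangular convolution with `t^m/(m+1)!` (`coeff_exp_zerosOne`). The formal solution has coefficient
`t^(n+2)/(n!(n+2))` there, and the resulting recursion is the Bernoulli recursion.

This needs the coordinates to exist for an arbitrary monomial basis, since `firstKindCoord` is 0
otherwise. The inputs `1` and `τ` are monomials, so with weights 1 and 2 on `X_0`, `X_1` the
operator `t d/dt` acts on the solution as the Euler derivation `E`, and the formal equation becomes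
the algebraic one `E x = x A` with `A = t X_0 + t^2 X_1`. Writing `x = exp Z`, the formula for the
derivative of the exponential (`euler_exp`) turns it into `(1 - e^{-ad_Z})/ad_Z (E Z) = A`. A
fixed-point iteration, contracting for the word-length filtration and made only of brackets, solves
it by a Lie series (`exists_log_mem_completion`). -/

theorem fsMul_nil (S T : FormalSeries 𝕂 I) : fsMul S T [] = S [] * T [] := by
  simp [fsMul]

theorem fsMul_cons (S T : FormalSeries 𝕂 I) (i : I) (σ : List I) :
    fsMul S T (i :: σ) = S [] * T (i :: σ) + fsMul (fun ρ => S (i :: ρ)) T σ := by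
  simp only [fsMul, List.length_cons]
  rw [Finset.sum_range_succ', add_comm]
  simp

/-- The formal equation multiplies by a letter on the right, so the recursions along solutions strip
the last letter. -/
theorem fsMul_append_singleton (S T : FormalSeries 𝕂 I) (σ : List I) (i : I) :
    fsMul S T (σ ++ [i]) = fsMul S (fun ρ => T (ρ ++ [i])) σ + S (σ ++ [i]) * T [] := by
  simp only [fsMul, List.length_append, List.length_singleton]
  rw [Finset.sum_range_succ]
  congr 1
  · refine Finset.sum_congr rfl fun j hj => ?_
    have hj : j ≤ σ.length := by simpa [Nat.lt_succ_iff] using hj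
    rw [List.take_append_of_le_length hj, List.drop_append_of_le_length hj]
  · rw [List.take_of_length_le (by simp), List.drop_of_length_le (by simp)]

theorem fsMul_add (S T T' : FormalSeries 𝕂 I) (σ : List I) :
    fsMul S (fun ρ => T ρ + T' ρ) σ = fsMul S T σ + fsMul S T' σ := by
  simp [fsMul, mul_add, Finset.sum_add_distrib]

theorem add_fsMul (S S' T : FormalSeries 𝕂 I) (σ : List I) :
    fsMul (fun ρ => S ρ + S' ρ) T σ = fsMul S T σ + fsMul S' T σ := by
  simp [fsMul, add_mul, Finset.sum_add_distrib]

theorem smul_fsMul (c : 𝕂) (S T : FormalSeries 𝕂 I) (σ : List I) :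
    fsMul (fun ρ => c * S ρ) T σ = c * fsMul S T σ := by
  simp [fsMul, Finset.mul_sum, mul_assoc]

theorem fsMul_smul (c : 𝕂) (S T : FormalSeries 𝕂 I) (σ : List I) :
    fsMul S (fun ρ => c * T ρ) σ = c * fsMul S T σ := by
  simp [fsMul, Finset.mul_sum, mul_left_comm]

/-- Stripping the first letter acts as a Leibniz rule (`fsMul_cons`), so the induction runs on the
word with `S` replaced by its left derivative. -/
theorem fsMul_assoc (S T U : FormalSeries 𝕂 I) (σ : List I) :
    fsMul (fsMul S T) U σ = fsMul S (fsMul T U) σ := by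
  induction σ generalizing S T with
  | nil => simp [fsMul_nil, mul_assoc]
  | cons i σ ih =>
    rw [fsMul_cons, fsMul_cons S, fsMul_cons T, fsMul_nil, ← ih]
    have : (fun ρ => fsMul S T (i :: ρ)) =
        fun ρ => S [] * T (i :: ρ) + fsMul (fun ρ => S (i :: ρ)) T ρ :=
      funext fun ρ => fsMul_cons S T i ρ
    rw [this, add_fsMul, smul_fsMul]
    ring

theorem fsOne_fsMul (S : FormalSeries 𝕂 I) (σ : List I) : fsMul fsOne S σ = S σ := by
  cases σ with
  | nil => simp [fsMul_nil, fsOne]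
  | cons i σ => rw [fsMul_cons]; simp [fsOne, fsMul]

theorem fsMul_fsOne (S : FormalSeries 𝕂 I) (σ : List I) : fsMul S fsOne σ = S σ := by
  induction σ generalizing S with
  | nil => simp [fsMul_nil, fsOne]
  | cons i σ ih => rw [fsMul_cons, ih]; simp [fsOne]

end SeriesMul

/-- Formal series, with the concatenation product as multiplication. -/
def NCSeries (𝕂 I : Type) : Type := List I → 𝕂

namespace NCSeries

variable {𝕂 I : Type} [RCLike 𝕂]

noncomputable instance : AddCommGroup (NCSeries 𝕂 I) := inferInstanceAs (AddCommGroup (List I → 𝕂))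

noncomputable instance : Module 𝕂 (NCSeries 𝕂 I) := inferInstanceAs (Module 𝕂 (List I → 𝕂))

noncomputable instance : Ring (NCSeries 𝕂 I) :=
  { (inferInstance : AddCommGroup (NCSeries 𝕂 I)) with
    mul := fsMul
    one := fsOne
    left_distrib := fun S T T' => funext fun σ => fsMul_add S T T' σ
    right_distrib := fun S S' T => funext fun σ => add_fsMul S S' T σ
    zero_mul := fun S => funext fun σ => by
      change fsMul (fun _ => 0) S σ = 0
      simp [fsMul]
    mul_zero := fun S => funext fun σ => by
      change fsMul S (fun _ => 0) σ = 0
      simp [fsMul]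
    mul_assoc := fun S T U => funext fun σ => fsMul_assoc S T U σ
    one_mul := fun S => funext fun σ => fsOne_fsMul S σ
    mul_one := fun S => funext fun σ => fsMul_fsOne S σ }

noncomputable instance : Algebra 𝕂 (NCSeries 𝕂 I) :=
  Algebra.ofModule (fun c S T => funext fun σ => smul_fsMul c S T σ)
    (fun c S T => funext fun σ => fsMul_smul c S T σ)

/-- The coefficient on a word, as a linear form. -/
noncomputable def coeff (σ : List I) : NCSeries 𝕂 I →ₗ[𝕂] 𝕂 where
  toFun S := S σ
  map_add' _ _ := rfl
  map_smul' _ _ := rfl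

@[ext] theorem ext {S T : NCSeries 𝕂 I} (h : ∀ σ, coeff σ S = coeff σ T) : S = T := funext h

theorem coeff_mul (S T : NCSeries 𝕂 I) (σ : List I) : coeff σ (S * T) = fsMul S T σ := rfl

/-- A family of coefficients, as an element of the ring of series. -/
def ofFun (S : FormalSeries 𝕂 I) : NCSeries 𝕂 I := S

theorem coeff_ofFun (S : FormalSeries 𝕂 I) (σ : List I) : coeff σ (ofFun S) = S σ := rfl

/-- The series `i⁻¹ S` of the suffixes of `i` in `S`. -/
def leftDeriv (i : I) (S : NCSeries 𝕂 I) : NCSeries 𝕂 I := fun σ => S (i :: σ)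

/-- The series `S i⁻¹` of the prefixes of `i` in `S`. -/
def rightDeriv (i : I) (S : NCSeries 𝕂 I) : NCSeries 𝕂 I := fun σ => S (σ ++ [i])

theorem coeff_leftDeriv (i : I) (S : NCSeries 𝕂 I) (σ : List I) :
    coeff σ (leftDeriv i S) = coeff (i :: σ) S := rfl

theorem coeff_rightDeriv (i : I) (S : NCSeries 𝕂 I) (σ : List I) :
    coeff σ (rightDeriv i S) = coeff (σ ++ [i]) S := rfl

theorem coeff_mul_nil (S T : NCSeries 𝕂 I) : coeff [] (S * T) = coeff [] S * coeff [] T :=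
  fsMul_nil (𝕂 := 𝕂) S T

theorem coeff_mul_cons (S T : NCSeries 𝕂 I) (i : I) (σ : List I) :
    coeff (i :: σ) (S * T) = coeff [] S * coeff (i :: σ) T + coeff σ (leftDeriv i S * T) :=
  fsMul_cons (𝕂 := 𝕂) S T i σ

theorem coeff_mul_append_singleton (S T : NCSeries 𝕂 I) (σ : List I) (i : I) :
    coeff (σ ++ [i]) (S * T) = coeff σ (S * rightDeriv i T) + coeff (σ ++ [i]) S * coeff [] T :=
  fsMul_append_singleton (𝕂 := 𝕂) S T σ i

theorem coeff_one_nil : coeff [] (1 : NCSeries 𝕂 I) = 1 := rfl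

theorem coeff_one_cons (i : I) (σ : List I) : coeff (i :: σ) (1 : NCSeries 𝕂 I) = 0 := rfl

theorem fsPow_eq (S : NCSeries 𝕂 I) (m : ℕ) : fsPow S m = S ^ m := by
  induction m with
  | zero => rw [pow_zero]; rfl
  | succ m ih => rw [pow_succ, ← ih]; rfl

/-! ### The word-length filtration and truncated exponentials. -/

/-- The series whose coefficients vanish on the words of length `< n`. -/
def order (𝕂 I : Type) [RCLike 𝕂] (n : ℕ) : Submodule 𝕂 (NCSeries 𝕂 I) where
  carrier := {S | ∀ σ : List I, σ.length < n → coeff σ S = 0}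
  add_mem' hS hT σ h := by rw [map_add, hS σ h, hT σ h, add_zero]
  zero_mem' σ _ := map_zero _
  smul_mem' c S hS σ h := by rw [map_smul, hS σ h, smul_zero]

theorem order_anti {m n : ℕ} (h : m ≤ n) : order 𝕂 I n ≤ order 𝕂 I m :=
  fun _ hS σ hσ => hS σ (hσ.trans_le h)

theorem mem_order_zero (S : NCSeries 𝕂 I) : S ∈ order 𝕂 I 0 := fun _ h => absurd h (by simp)

theorem mul_mem_order {m n : ℕ} {S T : NCSeries 𝕂 I} (hS : S ∈ order 𝕂 I m)
    (hT : T ∈ order 𝕂 I n) : S * T ∈ order 𝕂 I (m + n) := by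
  intro σ hσ
  rw [coeff_mul]
  refine Finset.sum_eq_zero fun i _ => ?_
  by_cases h : (σ.take i).length < m
  · rw [show S (σ.take i) = 0 from hS _ h, zero_mul]
  · rw [show T (σ.drop i) = 0 from hT _ ?_, mul_zero]
    simp only [List.length_take, List.length_drop] at h ⊢
    omega

theorem pow_mem_order {S : NCSeries 𝕂 I} (hS : S ∈ order 𝕂 I 1) (m : ℕ) :
    S ^ m ∈ order 𝕂 I m := by
  induction m with
  | zero => exact mem_order_zero _
  | succ m ih => rw [pow_succ]; exact mul_mem_order ih hS

theorem mem_order_one {S : NCSeries 𝕂 I} : S ∈ order 𝕂 I 1 ↔ coeff [] S = 0 := by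
  refine ⟨fun h => h [] (by simp), fun h σ hσ => ?_⟩
  have : σ = [] := List.length_eq_zero_iff.mp (by omega)
  rwa [this]

/-- The truncated exponential. -/
noncomputable def expSum (S : NCSeries 𝕂 I) (N : ℕ) : NCSeries 𝕂 I :=
  ∑ m ∈ Finset.range (N + 1), ((m.factorial : 𝕂))⁻¹ • S ^ m

/-- The exponential of a series without constant term. -/
noncomputable def exp (S : NCSeries 𝕂 I) : NCSeries 𝕂 I := fsExp S

theorem coeff_exp {S : NCSeries 𝕂 I} (hS : S ∈ order 𝕂 I 1) {σ : List I} {N : ℕ}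
    (h : σ.length ≤ N) : coeff σ (exp S) = coeff σ (expSum S N) := by
  have h1 : coeff σ (exp S) =
      ∑ m ∈ Finset.range (σ.length + 1), coeff σ (((m.factorial : 𝕂))⁻¹ • S ^ m) := by
    change ∑ m ∈ Finset.range (σ.length + 1), ((m.factorial : 𝕂))⁻¹ * fsPow S m σ = _
    refine Finset.sum_congr rfl fun m _ => ?_
    rw [fsPow_eq]; rfl
  rw [h1, expSum, map_sum]
  refine Finset.sum_subset (Finset.range_subset_range.mpr (by omega)) fun m _ hm => ?_
  rw [map_smul, pow_mem_order hS m σ (by simpa using hm), smul_zero]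

end NCSeries

/-! ### The Euler derivation and the derivative of the exponential -/

/-- The weight of a word. -/
def wordWeight {I : Type} (w : I → ℕ) (σ : List I) : ℕ := (σ.map w).sum

theorem wordWeight_append {I : Type} (w : I → ℕ) (σ ρ : List I) :
    wordWeight w (σ ++ ρ) = wordWeight w σ + wordWeight w ρ := by simp [wordWeight]

theorem length_le_wordWeight {I : Type} {w : I → ℕ} (hw : ∀ i, 0 < w i) (σ : List I) :
    σ.length ≤ wordWeight w σ := by
  induction σ with
  | nil => simp
  | cons i σ ih =>
    have := hw i
    simp only [wordWeight, List.map_cons, List.sum_cons, List.length_cons] at ih ⊢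
    omega

namespace NCSeries

variable {𝕂 I : Type} [RCLike 𝕂] (w : I → ℕ)

/-- The derivation multiplying the coefficient on each word by its weight. -/
noncomputable def euler : NCSeries 𝕂 I →ₗ[𝕂] NCSeries 𝕂 I where
  toFun S := fun σ => (wordWeight w σ : 𝕂) * coeff σ S
  map_add' S T := funext fun σ => by
    change _ = (wordWeight w σ : 𝕂) * coeff σ S + (wordWeight w σ : 𝕂) * coeff σ T
    rw [map_add, mul_add]
  map_smul' c S := funext fun σ => by
    change _ = c * ((wordWeight w σ : 𝕂) * coeff σ S)
    rw [map_smul, smul_eq_mul, mul_left_comm]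

/-- Division of the coefficient on each word by its weight. -/
noncomputable def eulerInv : NCSeries 𝕂 I →ₗ[𝕂] NCSeries 𝕂 I where
  toFun S := fun σ => (wordWeight w σ : 𝕂)⁻¹ * coeff σ S
  map_add' S T := funext fun σ => by
    change _ = (wordWeight w σ : 𝕂)⁻¹ * coeff σ S + (wordWeight w σ : 𝕂)⁻¹ * coeff σ T
    rw [map_add, mul_add]
  map_smul' c S := funext fun σ => by
    change _ = c * ((wordWeight w σ : 𝕂)⁻¹ * coeff σ S)
    rw [map_smul, smul_eq_mul, mul_left_comm]

theorem coeff_euler (S : NCSeries 𝕂 I) (σ : List I) :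
    coeff σ (euler w S) = (wordWeight w σ : 𝕂) * coeff σ S := rfl

theorem coeff_eulerInv (S : NCSeries 𝕂 I) (σ : List I) :
    coeff σ (eulerInv w S) = (wordWeight w σ : 𝕂)⁻¹ * coeff σ S := rfl

theorem euler_mem_order {n : ℕ} {S : NCSeries 𝕂 I} (hS : S ∈ order 𝕂 I n) :
    euler w S ∈ order 𝕂 I n := fun σ hσ => by rw [coeff_euler, hS σ hσ, mul_zero]

theorem eulerInv_mem_order {n : ℕ} {S : NCSeries 𝕂 I} (hS : S ∈ order 𝕂 I n) :
    eulerInv w S ∈ order 𝕂 I n := fun σ hσ => by rw [coeff_eulerInv, hS σ hσ, mul_zero]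

theorem euler_mem_order_one (S : NCSeries 𝕂 I) : euler w S ∈ order 𝕂 I 1 := by
  rw [mem_order_one, coeff_euler]; simp [wordWeight]

theorem euler_eulerInv {w : I → ℕ} (hw : ∀ i, 0 < w i) {S : NCSeries 𝕂 I}
    (hS : S ∈ order 𝕂 I 1) : euler w (eulerInv w S) = S := by
  ext σ
  rw [coeff_euler, coeff_eulerInv]
  rcases Nat.eq_zero_or_pos σ.length with h | h
  · rw [hS σ (by omega)]; simp
  · have : (wordWeight w σ : 𝕂) ≠ 0 := by
      have := length_le_wordWeight hw σ
      exact_mod_cast (by omega : wordWeight w σ ≠ 0)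
    rw [mul_inv_cancel_left₀ this]

/-- The weight is additive under concatenation. -/
theorem euler_mul (S T : NCSeries 𝕂 I) :
    euler w (S * T) = euler w S * T + S * euler w T := by
  ext σ
  rw [map_add, coeff_euler, coeff_mul, coeff_mul, coeff_mul]
  simp only [fsMul]
  rw [Finset.mul_sum, ← Finset.sum_add_distrib]
  refine Finset.sum_congr rfl fun i _ => ?_
  change _ = (wordWeight w (σ.take i) : 𝕂) * S (σ.take i) * T (σ.drop i) +
    S (σ.take i) * ((wordWeight w (σ.drop i) : 𝕂) * T (σ.drop i))
  have : wordWeight w σ = wordWeight w (σ.take i) + wordWeight w (σ.drop i) := by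
    rw [← wordWeight_append, List.take_append_drop]
  rw [this]; push_cast; ring

theorem euler_one : euler w (1 : NCSeries 𝕂 I) = 0 := by
  have := euler_mul w (1 : NCSeries 𝕂 I) 1
  simpa using this

/-- The iterated commutators `ad_S^k(T)`. -/
noncomputable def adPow (S T : NCSeries 𝕂 I) : ℕ → NCSeries 𝕂 I
  | 0 => T
  | k + 1 => S * adPow S T k - adPow S T k * S

/-- `S` and `E S` do not commute. Moving every `S` to the left of `E S` produces iterated
commutators, whose binomial coefficients are collected by Pascal's rule. -/
theorem euler_pow_succ (S : NCSeries 𝕂 I) (m : ℕ) :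
    euler w (S ^ (m + 1)) = ∑ p ∈ Finset.HasAntidiagonal.antidiagonal m,
      ((-1 : 𝕂) ^ p.2 * ((m + 1).choose (p.2 + 1) : 𝕂)) • (S ^ p.1 * adPow S (euler w S) p.2) := by
  induction m with
  | zero => simp [adPow]
  | succ m ih =>
    set D := adPow S (euler w S) with hD
    -- Each `S` moved across `D k` costs one more commutator.
    have hshift : ∀ a k, S ^ a * D k * S = S ^ (a + 1) * D k - S ^ a * D (k + 1) := by
      intro a k
      have : D (k + 1) = S * D k - D k * S := rfl
      rw [this]; noncomm_ring
    -- The extra term has coefficient `(m+1).choose (m+2) = 0`.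
    have h1 : ∑ p ∈ Finset.HasAntidiagonal.antidiagonal (m + 1),
        ((-1 : 𝕂) ^ p.2 * ((m + 1).choose (p.2 + 1) : 𝕂)) • (S ^ p.1 * D p.2) =
        ∑ p ∈ Finset.HasAntidiagonal.antidiagonal m,
          ((-1 : 𝕂) ^ p.2 * ((m + 1).choose (p.2 + 1) : 𝕂)) • (S ^ (p.1 + 1) * D p.2) := by
      rw [Finset.Nat.sum_antidiagonal_succ]
      simp
    have h2 : ∑ p ∈ Finset.HasAntidiagonal.antidiagonal (m + 1),
        ((-1 : 𝕂) ^ p.2 * ((m + 1).choose p.2 : 𝕂)) • (S ^ p.1 * D p.2) =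
        S ^ (m + 1) * euler w S - ∑ p ∈ Finset.HasAntidiagonal.antidiagonal m,
          ((-1 : 𝕂) ^ p.2 * ((m + 1).choose (p.2 + 1) : 𝕂)) • (S ^ p.1 * D (p.2 + 1)) := by
      rw [Finset.Nat.sum_antidiagonal_succ', sub_eq_add_neg, ← Finset.sum_neg_distrib]
      congr 1
      · simp [hD, adPow]
      · refine Finset.sum_congr rfl fun p _ => ?_
        rw [← neg_smul]; congr 1; ring
    rw [pow_succ, euler_mul, ih, Finset.sum_mul]
    simp_rw [smul_mul_assoc, hshift, smul_sub]
    rw [Finset.sum_sub_distrib, ← h1, sub_add_eq_add_sub, add_sub_assoc, ← h2,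
      ← Finset.sum_add_distrib]
    refine Finset.sum_congr rfl fun p _ => ?_
    rw [← add_smul]
    congr 1
    rw [Nat.choose_succ_succ (m + 1) p.2]; push_cast; ring

/-- The truncation of `(1 - e^{-ad_S}) / ad_S` applied to `E S`. -/
noncomputable def phiSum (S : NCSeries 𝕂 I) (N : ℕ) : NCSeries 𝕂 I :=
  ∑ k ∈ Finset.range (N + 1),
    ((-1 : 𝕂) ^ k * (((k + 1).factorial : 𝕂))⁻¹) • adPow S (euler w S) k

theorem adPow_mem_order {S T : NCSeries 𝕂 I} (hS : S ∈ order 𝕂 I 1) (hT : T ∈ order 𝕂 I 1)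
    (k : ℕ) : adPow S T k ∈ order 𝕂 I (k + 1) := by
  induction k with
  | zero => exact hT
  | succ k ih =>
    refine Submodule.sub_mem _ ?_ (mul_mem_order ih hS)
    rw [add_comm]; exact mul_mem_order hS ih

/-- After division by `(m+1)!` the binomial coefficient splits as `1/(p.1! (p.2+1)!)`, so the sum
becomes a Cauchy product. -/
theorem euler_expSum (S : NCSeries 𝕂 I) (N : ℕ) :
    euler w (expSum S (N + 1)) = ∑ m ∈ Finset.range (N + 1), ∑ p ∈ Finset.HasAntidiagonal.antidiagonal m,
      (((p.1.factorial : 𝕂))⁻¹ • S ^ p.1) *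
        (((-1 : 𝕂) ^ p.2 * (((p.2 + 1).factorial : 𝕂))⁻¹) • adPow S (euler w S) p.2) := by
  rw [expSum, Finset.sum_range_succ', map_add, map_sum]
  simp only [pow_zero, map_smul, euler_one, smul_zero, add_zero]
  refine Finset.sum_congr rfl fun m _ => ?_
  rw [euler_pow_succ, Finset.smul_sum]
  refine Finset.sum_congr rfl fun p hp => ?_
  rw [smul_mul_smul_comm, smul_smul]
  congr 1
  have hp : p.1 + p.2 = m := by simpa using hp
  have hc : ((m + 1).choose (p.2 + 1) : 𝕂) * (p.2 + 1).factorial * p.1.factorial =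
      (m + 1).factorial := by
    have h := Nat.choose_mul_factorial_mul_factorial (show p.2 + 1 ≤ m + 1 by omega)
    rw [show m + 1 - (p.2 + 1) = p.1 by omega] at h
    exact_mod_cast h
  have h1 : ((m + 1).factorial : 𝕂) ≠ 0 := by exact_mod_cast Nat.factorial_ne_zero _
  have h2 : ((p.2 + 1).factorial : 𝕂) ≠ 0 := by exact_mod_cast Nat.factorial_ne_zero _
  have h3 : (p.1.factorial : 𝕂) ≠ 0 := by exact_mod_cast Nat.factorial_ne_zero _
  field_simp
  linear_combination hc

theorem sum_range_antidiagonal_eq {R : Type*} [AddCommMonoid R] (f : ℕ × ℕ → R) (N : ℕ)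
    (hf : ∀ p : ℕ × ℕ, N < p.1 + p.2 → f p = 0) :
    ∑ m ∈ Finset.range (N + 1), ∑ p ∈ Finset.HasAntidiagonal.antidiagonal m, f p =
      ∑ a ∈ Finset.range (N + 1), ∑ k ∈ Finset.range (N + 1), f (a, k) := by
  rw [← Finset.sum_product']
  rw [← Finset.sum_filter_add_sum_filter_not (Finset.range (N + 1) ×ˢ Finset.range (N + 1))
    (fun p => p.1 + p.2 < N + 1)]
  rw [Finset.sum_eq_zero (s := Finset.filter (fun p => ¬ p.1 + p.2 < N + 1) _)
    (fun p hp => hf p (by have := (Finset.mem_filter.mp hp).2; omega)),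
    add_zero]
  rw [← Finset.sum_fiberwise_of_maps_to (t := Finset.range (N + 1)) (g := fun p : ℕ × ℕ => p.1 + p.2)
    (fun p hp => by simpa using (Finset.mem_filter.mp hp).2)]
  refine Finset.sum_congr rfl fun m hm => Finset.sum_congr ?_ fun _ _ => rfl
  ext p
  simp only [Finset.HasAntidiagonal.mem_antidiagonal, Finset.mem_filter, Finset.mem_product, Finset.mem_range]
    at hm ⊢
  omega

/-- The series `(1 - e^{-ad_S}) / ad_S` applied to `E S`. -/
noncomputable def phi (S : NCSeries 𝕂 I) : NCSeries 𝕂 I :=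
  fun σ => coeff σ (phiSum w S σ.length)

theorem coeff_phi {S : NCSeries 𝕂 I} (hS : S ∈ order 𝕂 I 1) {σ : List I} {N : ℕ}
    (h : σ.length ≤ N) : coeff σ (phi w S) = coeff σ (phiSum w S N) := by
  change coeff σ (phiSum w S σ.length) = _
  rw [phiSum, phiSum, map_sum, map_sum]
  refine Finset.sum_subset (Finset.range_subset_range.mpr (by omega)) fun k _ hk => ?_
  have hk : σ.length < k + 1 := by simp at hk; omega
  rw [map_smul, adPow_mem_order hS (euler_mem_order_one w S) k σ hk, smul_zero]

theorem coeff_mul_congr {S S' T T' : NCSeries 𝕂 I} {N : ℕ}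
    (hS : ∀ σ : List I, σ.length ≤ N → coeff σ S = coeff σ S')
    (hT : ∀ σ : List I, σ.length ≤ N → coeff σ T = coeff σ T') {σ : List I} (h : σ.length ≤ N) :
    coeff σ (S * T) = coeff σ (S' * T') := by
  rw [coeff_mul, coeff_mul]
  refine Finset.sum_congr rfl fun i _ => ?_
  exact congrArg₂ (· * ·) (hS _ (by simp; omega)) (hT _ (by simp; omega))

/-- Both factors may be truncated at the length of the word. The triangular sum of `euler_expSum`
then completes to a square one, because the added terms have order larger than that length. -/
theorem euler_exp {S : NCSeries 𝕂 I} (hS : S ∈ order 𝕂 I 1) :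
    euler w (exp S) = exp S * phi w S := by
  ext σ
  set N := σ.length with hN
  rw [coeff_mul_congr (N := N) (S' := expSum S N) (T' := phiSum w S N)
    (fun ρ hρ => coeff_exp hS hρ) (fun ρ hρ => coeff_phi w hS hρ) le_rfl]
  rw [coeff_euler, coeff_exp hS (Nat.le_succ _), ← coeff_euler, euler_expSum]
  simp only [map_sum]
  rw [sum_range_antidiagonal_eq (fun p => coeff σ ((((p.1.factorial : 𝕂))⁻¹ • S ^ p.1) *
        (((-1 : 𝕂) ^ p.2 * (((p.2 + 1).factorial : 𝕂))⁻¹) • adPow S (euler w S) p.2)))]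
  · rw [expSum, phiSum, Finset.sum_mul_sum]
    simp only [map_sum, hN]
  · intro p hp
    rw [smul_mul_smul_comm, map_smul,
      mul_mem_order (pow_mem_order hS p.1) (adPow_mem_order hS (euler_mem_order_one w S) p.2) σ
        (by omega), smul_zero]

/-! ### The logarithm as a Lie series -/

theorem sub_adPow_mem_order {S S' : NCSeries 𝕂 I} {n : ℕ} (h : S - S' ∈ order 𝕂 I n) (k : ℕ) :
    adPow S (euler w S) k - adPow S' (euler w S') k ∈ order 𝕂 I n := by
  induction k with
  | zero =>
    change euler w S - euler w S' ∈ _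
    rw [← map_sub]; exact euler_mem_order w h
  | succ k ih =>
    have h0 : ∀ U : NCSeries 𝕂 I, U ∈ order 𝕂 I 0 := mem_order_zero
    have e : adPow S (euler w S) (k + 1) - adPow S' (euler w S') (k + 1) =
        ((S - S') * adPow S (euler w S) k +
          S' * (adPow S (euler w S) k - adPow S' (euler w S') k)) -
        ((adPow S (euler w S) k - adPow S' (euler w S') k) * S +
          adPow S' (euler w S') k * (S - S')) := by
      simp only [adPow]; noncomm_ring
    rw [e]
    refine Submodule.sub_mem _ (Submodule.add_mem _ ?_ ?_) (Submodule.add_mem _ ?_ ?_)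
    · exact mul_mem_order (m := n) (n := 0) h (h0 _)
    · simpa using mul_mem_order (m := 0) (n := n) (h0 S') ih
    · exact mul_mem_order (m := n) (n := 0) ih (h0 _)
    · simpa using mul_mem_order (m := 0) (n := n) (h0 _) h

/-- In the telescoped difference of commutators, each term is a difference of order `n` times a
factor without constant term. This gain of one order makes `logStep` a contraction. -/
theorem sub_adPow_succ_mem_order {S S' : NCSeries 𝕂 I} {n : ℕ} (hS : S ∈ order 𝕂 I 1)
    (hS' : S' ∈ order 𝕂 I 1) (h : S - S' ∈ order 𝕂 I n) (k : ℕ) :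
    adPow S (euler w S) (k + 1) - adPow S' (euler w S') (k + 1) ∈ order 𝕂 I (n + 1) := by
  have ih := sub_adPow_mem_order w h k
  have hD : ∀ {U : NCSeries 𝕂 I}, U ∈ order 𝕂 I 1 → adPow U (euler w U) k ∈ order 𝕂 I 1 :=
    fun hU => order_anti (by omega) (adPow_mem_order hU (euler_mem_order_one w _) k)
  have e : adPow S (euler w S) (k + 1) - adPow S' (euler w S') (k + 1) =
      ((S - S') * adPow S (euler w S) k +
        S' * (adPow S (euler w S) k - adPow S' (euler w S') k)) -
      ((adPow S (euler w S) k - adPow S' (euler w S') k) * S +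
        adPow S' (euler w S') k * (S - S')) := by
    simp only [adPow]; noncomm_ring
  rw [e]
  refine Submodule.sub_mem _ (Submodule.add_mem _ (mul_mem_order h (hD hS)) ?_)
    (Submodule.add_mem _ (mul_mem_order ih hS) ?_)
  · rw [add_comm]; exact mul_mem_order hS' ih
  · rw [add_comm]; exact mul_mem_order (hD hS') h

theorem coeff_phi_sub_euler (S : NCSeries 𝕂 I) (σ : List I) :
    coeff σ (phi w S - euler w S) = ∑ k ∈ Finset.range σ.length,
      ((-1 : 𝕂) ^ (k + 1) * (((k + 2).factorial : 𝕂))⁻¹) *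
        coeff σ (adPow S (euler w S) (k + 1)) := by
  rw [map_sub]
  change coeff σ (phiSum w S σ.length) - _ = _
  rw [phiSum, Finset.sum_range_succ', map_add, map_sum]
  simp [adPow]

/-- The map whose fixed points solve `phi S = A`. -/
noncomputable def logStep (A S : NCSeries 𝕂 I) : NCSeries 𝕂 I :=
  eulerInv w (A - (phi w S - euler w S))

theorem logStep_mem_order {A S : NCSeries 𝕂 I} (hA : A ∈ order 𝕂 I 1) :
    logStep w A S ∈ order 𝕂 I 1 := by
  refine eulerInv_mem_order w (Submodule.sub_mem _ hA ?_)
  rw [mem_order_one, coeff_phi_sub_euler]; simp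

theorem logStep_sub_mem_order {A S S' : NCSeries 𝕂 I} {n : ℕ} (hS : S ∈ order 𝕂 I 1)
    (hS' : S' ∈ order 𝕂 I 1) (h : S - S' ∈ order 𝕂 I n) :
    logStep w A S - logStep w A S' ∈ order 𝕂 I (n + 1) := by
  rw [logStep, logStep, ← map_sub]
  refine eulerInv_mem_order w fun σ hσ => ?_
  rw [sub_sub_sub_cancel_left, map_sub, coeff_phi_sub_euler, coeff_phi_sub_euler,
    ← Finset.sum_sub_distrib]
  refine Finset.sum_eq_zero fun k _ => ?_
  rw [← mul_sub, ← map_sub, ← neg_sub, map_neg, sub_adPow_succ_mem_order w hS hS' h k σ hσ]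
  simp

/-! ### Closures of Lie subspaces and existence of a logarithm. -/

/-- The closure of a subspace for the topology defined by `order`. -/
def completion (P : Submodule 𝕂 (NCSeries 𝕂 I)) : Submodule 𝕂 (NCSeries 𝕂 I) where
  carrier := {S | ∀ n, ∃ p ∈ P, p - S ∈ order 𝕂 I n}
  add_mem' {S T} hS hT n := by
    obtain ⟨p, hp, h⟩ := hS n
    obtain ⟨q, hq, h'⟩ := hT n
    exact ⟨p + q, P.add_mem hp hq, by rw [add_sub_add_comm]; exact Submodule.add_mem _ h h'⟩
  zero_mem' n := ⟨0, P.zero_mem, by simp⟩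
  smul_mem' c S hS n := by
    obtain ⟨p, hp, h⟩ := hS n
    exact ⟨c • p, P.smul_mem c hp, by rw [← smul_sub]; exact Submodule.smul_mem _ c h⟩

theorem le_completion (P : Submodule 𝕂 (NCSeries 𝕂 I)) : P ≤ completion P :=
  fun p hp _ => ⟨p, hp, by simp⟩

theorem mem_completion_of_forall {P : Submodule 𝕂 (NCSeries 𝕂 I)} {S : NCSeries 𝕂 I}
    (h : ∀ n, ∃ T ∈ completion P, T - S ∈ order 𝕂 I n) : S ∈ completion P := by
  intro n
  obtain ⟨T, hT, hTS⟩ := h n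
  obtain ⟨p, hp, hpT⟩ := hT n
  exact ⟨p, hp, by rw [← sub_add_sub_cancel p T S]; exact Submodule.add_mem _ hpT hTS⟩

theorem map_mem_completion {P : Submodule 𝕂 (NCSeries 𝕂 I)} {f : NCSeries 𝕂 I →ₗ[𝕂] NCSeries 𝕂 I}
    (hf : ∀ n, ∀ S ∈ order 𝕂 I n, f S ∈ order 𝕂 I n) (hP : ∀ p ∈ P, f p ∈ P)
    {S : NCSeries 𝕂 I} (hS : S ∈ completion P) : f S ∈ completion P := by
  intro n
  obtain ⟨p, hp, h⟩ := hS n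
  exact ⟨f p, hP p hp, by rw [← map_sub]; exact hf n _ h⟩

theorem commutator_mem_completion {P : Submodule 𝕂 (NCSeries 𝕂 I)}
    (hP : ∀ p ∈ P, ∀ q ∈ P, p * q - q * p ∈ P) {S T : NCSeries 𝕂 I} (hS : S ∈ completion P)
    (hT : T ∈ completion P) : S * T - T * S ∈ completion P := by
  intro n
  obtain ⟨p, hp, h⟩ := hS n
  obtain ⟨q, hq, h'⟩ := hT n
  have h0 : ∀ U : NCSeries 𝕂 I, U ∈ order 𝕂 I 0 := mem_order_zero
  refine ⟨_, hP p hp q hq, ?_⟩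
  have e : p * q - q * p - (S * T - T * S) =
      ((p - S) * q + S * (q - T)) - ((q - T) * p + T * (p - S)) := by noncomm_ring
  rw [e]
  refine Submodule.sub_mem _ (Submodule.add_mem _ ?_ ?_) (Submodule.add_mem _ ?_ ?_)
  · exact mul_mem_order (m := n) (n := 0) h (h0 _)
  · simpa using mul_mem_order (m := 0) (n := n) (h0 S) h'
  · exact mul_mem_order (m := n) (n := 0) h' (h0 _)
  · simpa using mul_mem_order (m := 0) (n := n) (h0 T) h

/-- Each operation in `logStep` is a commutator, a linear combination, `E` or its inverse, or a
limit in the filtration, and the closure is stable under all of them. -/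
theorem logStep_mem_completion {P : Submodule 𝕂 (NCSeries 𝕂 I)}
    (hP : ∀ p ∈ P, ∀ q ∈ P, p * q - q * p ∈ P) (hE : ∀ p ∈ P, euler w p ∈ P)
    (hE' : ∀ p ∈ P, eulerInv w p ∈ P) {A S : NCSeries 𝕂 I} (hA : A ∈ P)
    (hS1 : S ∈ order 𝕂 I 1) (hS : S ∈ completion P) : logStep w A S ∈ completion P := by
  have hES : euler w S ∈ completion P := map_mem_completion (fun _ _ => euler_mem_order w) hE hS
  have hD : ∀ k, adPow S (euler w S) k ∈ completion P := by
    intro k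
    induction k with
    | zero => exact hES
    | succ k ih => exact commutator_mem_completion hP hS ih
  have hphi : phi w S ∈ completion P := by
    refine mem_completion_of_forall fun n => ⟨phiSum w S n, ?_, fun σ hσ => ?_⟩
    · exact Submodule.sum_mem _ fun k _ => Submodule.smul_mem _ _ (hD k)
    · rw [map_sub, coeff_phi w hS1 hσ.le, sub_self]
  exact map_mem_completion (fun _ _ => eulerInv_mem_order w) hE'
    (Submodule.sub_mem _ (le_completion P hA) (Submodule.sub_mem _ hphi hES))

/-- Banach's fixed-point argument for the filtration: the Picard iterates from 0 stay in the
closure, and each step fixes one more word length. -/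
theorem exists_log_mem_completion {w : I → ℕ} (hw : ∀ i, 0 < w i)
    {P : Submodule 𝕂 (NCSeries 𝕂 I)}
    (hP : ∀ p ∈ P, ∀ q ∈ P, p * q - q * p ∈ P) (hE : ∀ p ∈ P, euler w p ∈ P)
    (hE' : ∀ p ∈ P, eulerInv w p ∈ P) {A : NCSeries 𝕂 I} (hA : A ∈ P)
    (hA1 : A ∈ order 𝕂 I 1) :
    ∃ Z ∈ completion P, Z ∈ order 𝕂 I 1 ∧
      euler w (exp Z) = exp Z * A := by
  set z : ℕ → NCSeries 𝕂 I := fun n => (logStep w A)^[n] 0 with hz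
  have hzs : ∀ n, z (n + 1) = logStep w A (z n) := fun n => Function.iterate_succ_apply' _ _ _
  have hz1 : ∀ n, z n ∈ order 𝕂 I 1 := by
    intro n
    cases n with
    | zero => exact Submodule.zero_mem _
    | succ n => rw [hzs]; exact logStep_mem_order w hA1
  have hzP : ∀ n, z n ∈ completion P := by
    intro n
    induction n with
    | zero => exact Submodule.zero_mem _
    | succ n ih => rw [hzs]; exact logStep_mem_completion w hP hE hE' hA (hz1 n) ih
  have hstep : ∀ n, z (n + 1) - z n ∈ order 𝕂 I (n + 1) := by
    intro n
    induction n with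
    | zero => exact Submodule.sub_mem _ (hz1 1) (hz1 0)
    | succ n ih =>
      rw [hzs (n + 1), hzs n]
      exact logStep_sub_mem_order w (by rw [← hzs]; exact hz1 _) (hz1 n) (by rw [← hzs]; exact ih)
  have hdiff : ∀ n m, n ≤ m → z m - z n ∈ order 𝕂 I (n + 1) := by
    intro n m hnm
    induction m, hnm using Nat.le_induction with
    | base => simp
    | succ m hm ih =>
      rw [← sub_add_sub_cancel _ (z m)]
      exact Submodule.add_mem _ (order_anti (by omega) (hstep m)) ih
  -- The coefficient on a word no longer changes after as many iterations as the word has letters,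
  -- so this diagonal choice is the limit.
  set Z : NCSeries 𝕂 I := fun σ => coeff σ (z σ.length) with hZ
  have hZz : ∀ n, Z - z n ∈ order 𝕂 I (n + 1) := by
    intro n σ hσ
    have h := hdiff σ.length n (by omega) σ (by omega)
    rw [map_sub] at h ⊢
    change coeff σ (z σ.length) - _ = 0
    rw [← neg_sub, h, neg_zero]
  have hZ1 : Z ∈ order 𝕂 I 1 := by
    rw [← sub_add_cancel Z (z 0)]; exact Submodule.add_mem _ (hZz 0) (hz1 0)
  have hfix : logStep w A Z = Z := by
    ext σ
    have h1 := logStep_sub_mem_order (A := A) w hZ1 (hz1 σ.length) (hZz σ.length) σ (by omega)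
    have h2 := hZz (σ.length + 1) σ (by omega)
    rw [← hzs] at h1
    rw [map_sub, sub_eq_zero] at h1 h2
    rw [h1, h2]
  -- Applying `E` to the fixed-point equation gives `E Z = A - (phi Z - E Z)`, where `E Z` cancels.
  have hphi : phi w Z = A := by
    have h := euler_eulerInv hw (S := A - (phi w Z - euler w Z)) (Submodule.sub_mem _ hA1 (by
      rw [mem_order_one, coeff_phi_sub_euler]; simp))
    change euler w (logStep w A Z) = _ at h
    rw [hfix] at h
    have h' : A - phi w Z = 0 := by
      rwa [← sub_add, right_eq_add] at h
    exact (sub_eq_zero.mp h').symm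
  refine ⟨Z, mem_completion_of_forall fun n => ⟨z n, hzP n, ?_⟩, hZ1, ?_⟩
  · rw [← neg_sub]; exact Submodule.neg_mem _ (order_anti (by omega) (hZz n))
  · rw [euler_exp w hZ1, hphi]

end NCSeries

/-! ### Non-commutative polynomials as formal series -/

namespace NCSeries

variable {𝕂 I : Type} [RCLike 𝕂] [DecidableEq I]

/-- The indeterminates. -/
noncomputable def X (𝕂 : Type) {I : Type} [RCLike 𝕂] [DecidableEq I] (i : I) : NCSeries 𝕂 I :=
  fun σ => if σ = [i] then 1 else 0

theorem coeff_X (i : I) (σ : List I) : coeff σ (X 𝕂 i) = if σ = [i] then 1 else 0 := rfl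

theorem coeff_X_mul_nil (i : I) (S : NCSeries 𝕂 I) : coeff [] (X 𝕂 i * S) = 0 := by
  rw [coeff_mul_nil]; simp [coeff_X]

theorem leftDeriv_X (i j : I) : leftDeriv j (X 𝕂 i) = if j = i then 1 else 0 := by
  ext σ
  rw [coeff_leftDeriv, coeff_X]
  by_cases h : j = i
  · cases σ <;> simp [h, coeff_one_nil, coeff_one_cons]
  · simp [h]

theorem rightDeriv_X (i j : I) : rightDeriv j (X 𝕂 i) = if j = i then 1 else 0 := by
  ext σ
  rw [coeff_rightDeriv, coeff_X]
  by_cases h : j = i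
  · cases σ <;> simp [h, coeff_one_nil, coeff_one_cons]
  · cases σ <;> simp [h]

theorem coeff_X_mul_cons (i j : I) (S : NCSeries 𝕂 I) (σ : List I) :
    coeff (j :: σ) (X 𝕂 i * S) = if j = i then coeff σ S else 0 := by
  rw [coeff_mul_cons, leftDeriv_X]
  split_ifs <;> simp [coeff_X]

theorem coeff_mul_X_append (i j : I) (S : NCSeries 𝕂 I) (σ : List I) :
    coeff (σ ++ [j]) (S * X 𝕂 i) = if j = i then coeff σ S else 0 := by
  rw [coeff_mul_append_singleton, rightDeriv_X]
  split_ifs <;> simp [coeff_X]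

theorem coeff_prod_X (ρ σ : List I) :
    coeff σ ((ρ.map (X 𝕂)).prod) = if ρ = σ then 1 else 0 := by
  induction ρ generalizing σ with
  | nil => cases σ <;> simp [coeff_one_nil, coeff_one_cons]
  | cons i ρ ih =>
    rw [List.map_cons, List.prod_cons]
    cases σ with
    | nil => simp [coeff_X_mul_nil]
    | cons j σ =>
      rw [coeff_X_mul_cons, ih]
      by_cases h : j = i
      · subst h; simp
      · rw [if_neg h, if_neg]; simp [Ne.symm h]

/-- The formal series of a non-commutative polynomial. -/
noncomputable def ofFree (𝕂 I : Type) [RCLike 𝕂] [DecidableEq I] :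
    FreeAlgebra 𝕂 I →ₐ[𝕂] NCSeries 𝕂 I :=
  FreeAlgebra.lift 𝕂 (X 𝕂)

theorem ofFree_ι (i : I) : ofFree 𝕂 I (FreeAlgebra.ι 𝕂 i) = X 𝕂 i := by simp [ofFree]

/-- Both sides are linear in `p`, so it suffices to compare them on words. -/
theorem wordCoeff_eq_coeff (p : FreeAlgebra 𝕂 I) (σ : List I) :
    wordCoeff p σ = coeff σ (ofFree 𝕂 I p) := by
  obtain ⟨a, rfl⟩ := (FreeAlgebra.equivMonoidAlgebraFreeMonoid (R := 𝕂) (X := I)).symm.surjective p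
  rw [wordCoeff, AlgEquiv.apply_symm_apply]
  induction a using MonoidAlgebra.induction_linear with
  | zero => simp
  | add a b ha hb => rw [map_add, map_add, map_add, ← ha, ← hb]; simp
  | single ρ c =>
    have h : (FreeAlgebra.equivMonoidAlgebraFreeMonoid (R := 𝕂) (X := I)).symm
        (MonoidAlgebra.single ρ c) = c • (ρ.toList.map (FreeAlgebra.ι 𝕂)).prod := by
      change MonoidAlgebra.lift 𝕂 _ _ (FreeMonoid.lift (FreeAlgebra.ι 𝕂)) _ = _
      rw [MonoidAlgebra.lift_single, FreeMonoid.lift_apply]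
    rw [h, map_smul, map_list_prod, List.map_map, map_smul]
    have h2 : (ofFree 𝕂 I ∘ FreeAlgebra.ι 𝕂 : I → NCSeries 𝕂 I) = X 𝕂 := funext ofFree_ι
    rw [h2, coeff_prod_X]
    classical
    rw [MonoidAlgebra.coeff_single, Finsupp.single_apply]
    simp only [smul_eq_mul, mul_ite, mul_one, mul_zero]
    congr

theorem ofFree_injective : Function.Injective (ofFree 𝕂 I) := by
  intro p q h
  apply (FreeAlgebra.equivMonoidAlgebraFreeMonoid (R := 𝕂) (X := I)).injective
  ext ρ
  have := wordCoeff_eq_coeff p ρ.toList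
  rw [h, ← wordCoeff_eq_coeff] at this
  exact this

end NCSeries

/-- The weight of a formal bracket. -/
def bracketWeight {I : Type} (w : I → ℕ) : FreeMagma I → ℕ
  | FreeMagma.of i => w i
  | FreeMagma.mul b c => bracketWeight w b + bracketWeight w c

namespace NCSeries

variable {𝕂 I : Type} [RCLike 𝕂] [DecidableEq I]

/-- The formal series of the evaluation of a formal bracket. -/
noncomputable def ofBracket (𝕂 : Type) [RCLike 𝕂] (b : FreeMagma I) : NCSeries 𝕂 I :=
  ofFree 𝕂 I (evalBracket 𝕂 b)

theorem ofBracket_of (i : I) : ofBracket 𝕂 (FreeMagma.of i) = X 𝕂 i := ofFree_ι i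

theorem ofBracket_mul (b c : FreeMagma I) : ofBracket 𝕂 (FreeMagma.mul b c) =
    ofBracket 𝕂 b * ofBracket 𝕂 c - ofBracket 𝕂 c * ofBracket 𝕂 b := by
  rw [ofBracket, evalBracket, Ring.lie_def, map_sub, map_mul, map_mul]; rfl

theorem euler_X (w : I → ℕ) (i : I) : euler w (X 𝕂 i) = (w i : 𝕂) • X 𝕂 i := by
  ext σ
  rw [coeff_euler, map_smul, coeff_X]
  split_ifs with h
  · simp [h, wordWeight]
  · simp

/-- A derivation respects commutators, so brackets are homogeneous for every choice of weights.
Weight 1 on all letters gives length, and an indicator weight counts one letter. -/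
theorem euler_ofBracket (w : I → ℕ) (b : FreeMagma I) :
    euler w (ofBracket 𝕂 b) = (bracketWeight w b : 𝕂) • ofBracket 𝕂 b := by
  induction b using FreeMagma.recOnMul with
  | ih1 i => rw [ofBracket_of, euler_X]; rfl
  | ih2 b c hb hc =>
    change euler w (ofBracket 𝕂 (FreeMagma.mul b c)) =
      (bracketWeight w (FreeMagma.mul b c) : 𝕂) • ofBracket 𝕂 (FreeMagma.mul b c)
    rw [ofBracket_mul, map_sub, euler_mul, euler_mul, hb, hc, bracketWeight]
    push_cast
    simp only [smul_mul_assoc, mul_smul_comm, add_smul, smul_sub]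
    abel

theorem wordWeight_eq_of_coeff_ne_zero (w : I → ℕ) {b : FreeMagma I} {σ : List I}
    (h : coeff σ (ofBracket 𝕂 b) ≠ 0) : wordWeight w σ = bracketWeight w b := by
  have h1 := congrArg (coeff σ) (euler_ofBracket (𝕂 := 𝕂) w b)
  rw [coeff_euler, map_smul, smul_eq_mul] at h1
  exact_mod_cast mul_right_cancel₀ h h1

theorem _root_.wordWeight_one {I : Type} (σ : List I) : wordWeight (fun _ => 1) σ = σ.length := by
  simp [wordWeight]

theorem length_eq_of_coeff_ne_zero {b : FreeMagma I} {σ : List I}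
    (h : coeff σ (ofBracket 𝕂 b) ≠ 0) : σ.length = bracketWeight (fun _ => 1) b := by
  rw [← wordWeight_one]; exact wordWeight_eq_of_coeff_ne_zero _ h

theorem eulerInv_ofBracket (w : I → ℕ) (b : FreeMagma I) :
    eulerInv w (ofBracket 𝕂 b) = (bracketWeight w b : 𝕂)⁻¹ • ofBracket 𝕂 b := by
  ext σ
  rw [coeff_eulerInv, map_smul, smul_eq_mul]
  by_cases h : coeff σ (ofBracket 𝕂 b) = 0
  · simp [h]
  · rw [wordWeight_eq_of_coeff_ne_zero w h]

theorem coeff_bracketSeries (B : Set (FreeMagma I)) (ζ : FreeMagma I → 𝕂) (σ : List I) :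
    bracketSeries B ζ σ = ∑ᶠ b : B, ζ b * coeff σ (ofBracket 𝕂 (b : FreeMagma I)) := by
  simp only [bracketSeries, wordCoeff_eq_coeff]; rfl

/-- A bracket has nonzero coefficients only on words of its own length. Its coordinate can thus be
read off the single approximation of that order, and approximations of different orders need not be
compatible. -/
theorem exists_bracketSeries_eq {B : Set (FreeMagma I)} {Z : NCSeries 𝕂 I}
    (hZ : Z ∈ completion (Submodule.span 𝕂 (ofBracket 𝕂 '' B))) :
    ∃ ζ : FreeMagma I → 𝕂, ofFun (bracketSeries B ζ) = Z := by
  classical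
  have hc : ∀ n : ℕ, ∃ c : B →₀ 𝕂, (c.sum fun b a => a • ofBracket 𝕂 (b : FreeMagma I)) - Z ∈
      order 𝕂 I (n + 1) := by
    intro n
    obtain ⟨p, hp, h⟩ := hZ (n + 1)
    rw [Set.image_eq_range, Finsupp.mem_span_range_iff_exists_finsupp] at hp
    obtain ⟨c, rfl⟩ := hp
    exact ⟨c, h⟩
  choose c hc using hc
  refine ⟨fun b => if hb : b ∈ B then c (bracketWeight (fun _ => 1) b) ⟨b, hb⟩ else 0, ?_⟩
  ext σ
  have h := hc σ.length σ (by omega)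
  rw [map_sub, sub_eq_zero, Finsupp.sum, map_sum] at h
  rw [coeff_ofFun, coeff_bracketSeries, ← h]
  have e : ∀ b : B, (if hb : (b : FreeMagma I) ∈ B then
      c (bracketWeight (fun _ => 1) (b : FreeMagma I)) ⟨b, hb⟩ else 0) *
      coeff σ (ofBracket 𝕂 (b : FreeMagma I)) =
      coeff σ (c σ.length b • ofBracket 𝕂 (b : FreeMagma I)) := by
    intro b
    rw [map_smul, smul_eq_mul, dif_pos b.2]
    by_cases h0 : coeff σ (ofBracket 𝕂 (b : FreeMagma I)) = 0
    · rw [h0, mul_zero, mul_zero]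
    · rw [length_eq_of_coeff_ne_zero h0]
  rw [finsum_congr e]
  refine finsum_eq_sum_of_support_subset _ fun b hb => ?_
  rw [Finset.mem_coe, Finsupp.mem_support_iff]
  intro h0
  exact hb (by change coeff σ (c σ.length b • _) = 0; rw [h0, zero_smul, map_zero])

section

attribute [local instance] LieRing.ofAssociativeRing

theorem span_ofBracket_eq {B : Set (FreeMagma I)} (hB : IsMonomialBasis 𝕂 B) :
    Submodule.span 𝕂 (ofBracket 𝕂 '' B) =
      (freeLie 𝕂 I).toSubmodule.map (ofFree 𝕂 I).toLinearMap := by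
  rw [← hB.2, Submodule.map_span, Set.image_image]; rfl

/-- The spanning half of `IsMonomialBasis` identifies this span with the image of the free Lie
algebra. -/
theorem commutator_mem_span_ofBracket {B : Set (FreeMagma I)} (hB : IsMonomialBasis 𝕂 B) :
    ∀ p ∈ Submodule.span 𝕂 (ofBracket 𝕂 '' B), ∀ q ∈ Submodule.span 𝕂 (ofBracket 𝕂 '' B),
      p * q - q * p ∈ Submodule.span 𝕂 (ofBracket 𝕂 '' B) := by
  rw [span_ofBracket_eq hB]
  rintro _ ⟨p, hp, rfl⟩ _ ⟨q, hq, rfl⟩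
  refine ⟨⁅p, q⁆, (freeLie 𝕂 I).lie_mem hp hq, ?_⟩
  simp [Ring.lie_def]

theorem X_mem_span_ofBracket {B : Set (FreeMagma I)} (hB : IsMonomialBasis 𝕂 B) (i : I) :
    X 𝕂 i ∈ Submodule.span 𝕂 (ofBracket 𝕂 '' B) := by
  rw [span_ofBracket_eq hB]
  exact ⟨_, LieSubalgebra.subset_lieSpan ⟨i, rfl⟩, ofFree_ι i⟩

end

theorem map_mem_span {V : Type*} [AddCommGroup V] [Module 𝕂 V] {s : Set V} {f : V →ₗ[𝕂] V}
    (hf : ∀ v ∈ s, ∃ c : 𝕂, f v = c • v) :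
    ∀ p ∈ Submodule.span 𝕂 s, f p ∈ Submodule.span 𝕂 s := by
  intro p hp
  have : Submodule.span 𝕂 s ≤ (Submodule.span 𝕂 s).comap f := by
    refine Submodule.span_le.mpr fun v hv => ?_
    obtain ⟨c, hc⟩ := hf v hv
    change f v ∈ Submodule.span 𝕂 s
    rw [hc]
    exact Submodule.smul_mem _ _ (Submodule.subset_span hv)
  exact this hp

theorem exists_log_eq_bracketSeries {w : I → ℕ} (hw : ∀ i, 0 < w i) {B : Set (FreeMagma I)}
    (hB : IsMonomialBasis 𝕂 B) {A : NCSeries 𝕂 I}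
    (hA : A ∈ Submodule.span 𝕂 (Set.range (X 𝕂 (I := I)))) :
    ∃ ζ : FreeMagma I → 𝕂,
      euler w (exp (ofFun (bracketSeries B ζ))) =
        exp (ofFun (bracketSeries B ζ)) * A := by
  have hA' : A ∈ Submodule.span 𝕂 (ofBracket 𝕂 '' B) := by
    refine (Submodule.span_le (p := Submodule.span 𝕂 (ofBracket 𝕂 '' B))).mpr ?_ hA
    rintro _ ⟨i, rfl⟩
    exact X_mem_span_ofBracket hB i
  have hA1 : A ∈ order 𝕂 I 1 := by
    refine (Submodule.span_le (p := order 𝕂 I 1)).mpr ?_ hA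
    rintro _ ⟨i, rfl⟩
    exact mem_order_one.mpr (by simp [coeff_X])
  obtain ⟨Z, hZ, -, h⟩ := exists_log_mem_completion hw (commutator_mem_span_ofBracket hB)
    (map_mem_span (by rintro _ ⟨b, -, rfl⟩; exact ⟨_, euler_ofBracket w b⟩))
    (map_mem_span (by rintro _ ⟨b, -, rfl⟩; exact ⟨_, eulerInv_ofBracket w b⟩)) hA' hA1
  obtain ⟨ζ, rfl⟩ := exists_bracketSeries_eq hZ
  exact ⟨ζ, h⟩

/-! ### The formal solution for monomial inputs -/

/-- The coefficients of the solution of `E x = x (∑ X_i)`, on reversed words. -/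
noncomputable def chenRev (𝕂 : Type) [RCLike 𝕂] (w : I → ℕ) : List I → 𝕂
  | [] => 1
  | i :: ρ => chenRev 𝕂 w ρ / (wordWeight w (i :: ρ) : 𝕂)

/-- The solution of `E x = x (∑ t ^ w i X_i)` with constant term `1`. -/
noncomputable def chen (w : I → ℕ) (t : 𝕂) : FormalSeries 𝕂 I :=
  fun σ => chenRev 𝕂 w σ.reverse * t ^ wordWeight w σ

theorem _root_.wordWeight_reverse {I : Type} (w : I → ℕ) (σ : List I) :
    wordWeight w σ.reverse = wordWeight w σ := by
  simp [wordWeight, List.sum_reverse]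

theorem chen_append {I : Type} (w : I → ℕ) (t : 𝕂) (σ : List I) (i : I) :
    chen w t (σ ++ [i]) = chen w t σ * t ^ w i / ((wordWeight w σ + w i : ℕ) : 𝕂) := by
  simp only [chen, List.reverse_append, List.reverse_singleton, List.singleton_append, chenRev]
  have : wordWeight w (i :: σ.reverse) = wordWeight w σ + w i := by
    rw [← wordWeight_reverse w σ]; simp [wordWeight, add_comm]
  rw [this, wordWeight_append]
  have : wordWeight w [i] = w i := by simp [wordWeight]
  rw [this, pow_add]
  ring

/-- Comparing coefficients on `σ ++ [i]` gives a recursion on the last letter, solvable since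
weights are positive. -/
theorem eq_chen [Fintype I] {w : I → ℕ} (hw : ∀ i, 0 < w i) {t : 𝕂} {y : FormalSeries 𝕂 I}
    (h0 : y [] = 1) (hy : euler w (ofFun y) = ofFun y * ∑ i, t ^ w i • X 𝕂 i) : y = chen w t := by
  funext σ
  induction σ using List.reverseRecOn with
  | nil => rw [h0]; simp [chen, chenRev, wordWeight]
  | append_singleton σ i ih =>
    have h := congrArg (coeff (σ ++ [i])) hy
    rw [coeff_euler, coeff_ofFun, Finset.mul_sum, map_sum] at h
    simp only [mul_smul_comm, map_smul, coeff_mul_X_append, smul_eq_mul, coeff_ofFun, mul_ite, mul_zero,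
      Finset.sum_ite_eq, Finset.mem_univ, if_true] at h
    have hwt : wordWeight w (σ ++ [i]) = wordWeight w σ + w i := by
      rw [wordWeight_append]; simp [wordWeight]
    have hne : ((wordWeight w σ + w i : ℕ) : 𝕂) ≠ 0 := by
      have := hw i
      exact_mod_cast (by omega : wordWeight w σ + w i ≠ 0)
    rw [chen_append, eq_div_iff hne, mul_comm, ← hwt, h, ih, mul_comm]

theorem integral_pow_ofReal (t : ℝ) (n : ℕ) :
    ∫ τ in (0 : ℝ)..t, (τ : 𝕂) ^ n = (t : 𝕂) ^ (n + 1) / ((n + 1 : ℕ) : 𝕂) := by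
  have : (fun τ : ℝ => (τ : 𝕂) ^ n) = fun τ : ℝ => ((τ ^ n : ℝ) : 𝕂) := by
    funext τ; push_cast; rfl
  rw [this, RCLike.intervalIntegral_ofReal, integral_pow]
  push_cast
  simp

/-- With input `τ^(w i - 1)` every integrand is a monomial in `τ`, and integrating it divides by the
weight of the lengthened word, exactly as in `chenRev`. -/
theorem formalSolutionRev_eq {I : Type} {w : I → ℕ} (hw : ∀ i, 0 < w i) (xs : FormalSeries 𝕂 I)
    {a : I → ℝ → 𝕂} (ha : ∀ i τ, a i τ = (τ : 𝕂) ^ (w i - 1)) (ρ : List I) (t : ℝ) :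
    formalSolutionRev xs a ρ t = fsMul xs (chen w (t : 𝕂)) ρ.reverse := by
  induction ρ generalizing t with
  | nil => simp [formalSolutionRev, fsMul_nil, chen, chenRev, wordWeight]
  | cons i ρ ih =>
    change xs (i :: ρ).reverse + ∫ τ in (0 : ℝ)..t, formalSolutionRev xs a ρ τ * a i τ = _
    rw [List.reverse_cons, fsMul_append_singleton]
    simp only [ih, ha]
    have h1 : chen w (t : 𝕂) [] = 1 := by simp [chen, chenRev, wordWeight]
    rw [h1, mul_one, add_comm]
    congr 1
    simp only [fsMul, Finset.sum_mul]
    rw [intervalIntegral.integral_finsetSum]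
    · refine Finset.sum_congr rfl fun j _ => ?_
      rw [chen_append]
      set σ := ρ.reverse.drop j
      have e : ∀ τ : ℝ, xs (ρ.reverse.take j) * chen w (τ : 𝕂) σ * (τ : 𝕂) ^ (w i - 1) =
          (xs (ρ.reverse.take j) * chenRev 𝕂 w σ.reverse) *
            (τ : 𝕂) ^ (wordWeight w σ + w i - 1) := by
        intro τ
        have hi := hw i
        rw [show wordWeight w σ + w i - 1 = wordWeight w σ + (w i - 1) by omega, pow_add]
        simp only [chen]; ring
      simp only [e]
      rw [intervalIntegral.integral_const_mul, integral_pow_ofReal]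
      have hi := hw i
      rw [show wordWeight w σ + w i - 1 + 1 = wordWeight w σ + w i by omega, chen, pow_add]
      ring
    · intro j _
      apply Continuous.intervalIntegrable
      simp only [chen]
      have := RCLike.continuous_ofReal (K := 𝕂)
      fun_prop

theorem formalSolution_eq {I : Type} {w : I → ℕ} (hw : ∀ i, 0 < w i) (xs : FormalSeries 𝕂 I)
    {a : I → ℝ → 𝕂} (ha : ∀ i τ, a i τ = (τ : 𝕂) ^ (w i - 1)) (t : ℝ) :
    formalSolution xs a t = fsMul xs (chen w (t : 𝕂)) := by
  funext σ
  rw [formalSolution, formalSolutionRev_eq hw xs ha, List.reverse_reverse]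

/-- This rules out the default value 0 in `firstKindCoord`, for which the partial sums would
converge trivially. -/
theorem exists_isFirstKindAt [Fintype I] {w : I → ℕ} (hw : ∀ i, 0 < w i)
    {a : I → ℝ → 𝕂} (ha : ∀ i τ, a i τ = (τ : 𝕂) ^ (w i - 1)) {B : Set (FreeMagma I)}
    (hB : IsMonomialBasis 𝕂 B) (t : ℝ) : ∃ ζ : FreeMagma I → 𝕂, IsFirstKindAt B a t ζ := by
  obtain ⟨ζ, hζ⟩ := exists_log_eq_bracketSeries (A := ∑ i, (t : 𝕂) ^ w i • X 𝕂 i) hw hB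
    (Submodule.sum_mem _ fun i _ => Submodule.smul_mem _ _ (Submodule.subset_span ⟨i, rfl⟩))
  refine ⟨ζ, fun xs => ?_⟩
  rw [formalSolution_eq hw xs ha]
  congr 1
  refine (eq_chen hw ?_ hζ).symm
  simp [fsExp, fsPow, fsOne]

end NCSeries

/-! ### Brackets containing the second indeterminate at most once -/

namespace NCSeries

variable {𝕂 : Type} [RCLike 𝕂]

/-- The number of occurrences of `X_i` in a bracket. -/
def letterCount (i : Fin 2) : FreeMagma (Fin 2) → ℕ := bracketWeight (Pi.single i 1)

theorem letterCount_mul (i : Fin 2) (b c : FreeMagma (Fin 2)) :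
    letterCount i (b * c) = letterCount i b + letterCount i c := rfl

theorem ofBracket_mul' (b c : FreeMagma (Fin 2)) : ofBracket 𝕂 (b * c) =
    ofBracket 𝕂 b * ofBracket 𝕂 c - ofBracket 𝕂 c * ofBracket 𝕂 b := ofBracket_mul b c

theorem ofBracket_adBracket_succ (k : ℕ) : ofBracket 𝕂 (adBracket (k + 1)) =
    X 𝕂 0 * ofBracket 𝕂 (adBracket k) - ofBracket 𝕂 (adBracket k) * X 𝕂 0 := by
  rw [adBracket, ofBracket_mul, ofBracket_of]

/-- A bracket built from `X_0` alone contains `[X_0, X_0]` unless it is a single letter. -/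
theorem eq_of_zero_or_ofBracket_eq_zero {b : FreeMagma (Fin 2)} (h : letterCount 1 b = 0) :
    b = FreeMagma.of 0 ∨ ofBracket 𝕂 b = 0 := by
  induction b using FreeMagma.recOnMul with
  | ih1 i =>
    fin_cases i
    · exact Or.inl rfl
    · exact absurd h (by simp [letterCount, bracketWeight])
  | ih2 b c hb hc =>
    rw [letterCount_mul] at h
    right
    rw [ofBracket_mul']
    rcases hb (by omega) with rfl | hb
    · rcases hc (by omega) with rfl | hc
      · simp
      · simp [hc]
    · simp [hb]

/-- At each node one side has no `X_1`, hence is `X_0` or evaluates to 0; antisymmetry puts `X_0` on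
the left. -/
theorem exists_ofBracket_eq_smul {b : FreeMagma (Fin 2)} (h : letterCount 1 b = 1) :
    ∃ c : 𝕂, ofBracket 𝕂 b = c • ofBracket 𝕂 (adBracket (letterCount 0 b)) := by
  induction b using FreeMagma.recOnMul with
  | ih1 i =>
    fin_cases i
    · exact absurd h (by simp [letterCount, bracketWeight])
    · exact ⟨1, by simp [letterCount, bracketWeight, adBracket]⟩
  | ih2 b c hb hc =>
    have h0 : letterCount 0 (FreeMagma.of 0) = 1 := by simp [letterCount, bracketWeight]
    rw [letterCount_mul] at h
    rw [ofBracket_mul', letterCount_mul]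
    rcases Nat.eq_zero_or_pos (letterCount 1 b) with h1 | h1
    · rcases eq_of_zero_or_ofBracket_eq_zero (𝕂 := 𝕂) h1 with rfl | e
      · obtain ⟨a, ha⟩ := hc (by omega)
        refine ⟨a, ?_⟩
        rw [ha, ofBracket_of, h0, add_comm, ofBracket_adBracket_succ]
        simp [smul_sub]
      · exact ⟨0, by simp [e]⟩
    · rcases eq_of_zero_or_ofBracket_eq_zero (𝕂 := 𝕂) (b := c) (by omega) with rfl | e
      · obtain ⟨a, ha⟩ := hb (by omega)
        refine ⟨-a, ?_⟩
        rw [ha, ofBracket_of, h0, ofBracket_adBracket_succ]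
        simp only [smul_mul_assoc, mul_smul_comm, neg_smul, smul_sub]
        abel
      · exact ⟨0, by simp [e]⟩

theorem linearIndependent_ofBracket {B : Set (FreeMagma (Fin 2))} (hB : IsMonomialBasis 𝕂 B) :
    LinearIndependent 𝕂 (fun b : B => ofBracket 𝕂 (b : FreeMagma (Fin 2))) :=
  hB.1.map' (ofFree 𝕂 (Fin 2)).toLinearMap (LinearMap.ker_eq_bot.mpr ofFree_injective)

/-- Two distinct basis elements cannot be proportional. -/
theorem eq_adBracket {B : Set (FreeMagma (Fin 2))} (hB : IsMonomialBasis 𝕂 B)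
    (had : ∀ k, adBracket k ∈ B) {b : FreeMagma (Fin 2)} (hb : b ∈ B) (h : letterCount 1 b = 1) :
    b = adBracket (letterCount 0 b) := by
  by_contra hne
  obtain ⟨c, hc⟩ := exists_ofBracket_eq_smul (𝕂 := 𝕂) h
  have h1 := (linearIndependent_ofBracket hB).comp
    ![⟨b, hb⟩, ⟨adBracket (letterCount 0 b), had _⟩] (by
      intro i j hij
      fin_cases i <;> fin_cases j
      · rfl
      · exact absurd (congrArg Subtype.val hij) hne
      · exact absurd (congrArg Subtype.val hij).symm hne
      · rfl)
  have e : (fun b : B => ofBracket 𝕂 (b : FreeMagma (Fin 2))) ∘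
      ![⟨b, hb⟩, ⟨adBracket (letterCount 0 b), had _⟩] =
      ![ofBracket 𝕂 b, ofBracket 𝕂 (adBracket (letterCount 0 b))] := by
    funext i; fin_cases i <;> rfl
  rw [e] at h1
  have h2 := LinearIndependent.pair_iff.mp h1 1 (-c) (by rw [one_smul, hc, neg_smul, add_neg_cancel])
  exact one_ne_zero h2.1

/-- The word `0^n 1`. -/
def zerosOne (n : ℕ) : List (Fin 2) := List.replicate n 0 ++ [1]

theorem zerosOne_zero : zerosOne 0 = [1] := rfl

theorem zerosOne_succ (n : ℕ) : zerosOne (n + 1) = 0 :: zerosOne n := rfl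

theorem length_zerosOne (n : ℕ) : (zerosOne n).length = n + 1 := by simp [zerosOne]

/-- Among the terms of the expanded commutator, only the one with every `X_0` on the left ends in
`X_1`. -/
theorem coeff_adBracket_zerosOne (k : ℕ) :
    coeff (zerosOne k) (ofBracket 𝕂 (adBracket k)) = 1 := by
  induction k with
  | zero => rw [adBracket, ofBracket_of]; simp [zerosOne, coeff_X]
  | succ k ih =>
    rw [ofBracket_adBracket_succ, map_sub, zerosOne_succ, coeff_X_mul_cons, if_pos rfl, ih,
      ← zerosOne_succ, zerosOne, coeff_mul_X_append]
    simp

theorem letterCount_of_coeff_ne_zero {b : FreeMagma (Fin 2)} {σ : List (Fin 2)}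
    (h : coeff σ (ofBracket 𝕂 b) ≠ 0) (i : Fin 2) :
    letterCount i b = wordWeight (Pi.single i 1) σ :=
  (wordWeight_eq_of_coeff_ne_zero _ h).symm

theorem bracketSeries_replicate (B : Set (FreeMagma (Fin 2))) (ζ : FreeMagma (Fin 2) → 𝕂)
    {n : ℕ} (hn : n ≠ 1) : bracketSeries B ζ (List.replicate n 0) = 0 := by
  rw [coeff_bracketSeries]
  refine finsum_eq_zero_of_forall_eq_zero fun b => ?_
  by_contra h
  have h' := right_ne_zero_of_mul h
  have h0 := letterCount_of_coeff_ne_zero h' 0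
  have h1 := letterCount_of_coeff_ne_zero h' 1
  simp only [wordWeight, List.map_replicate, List.sum_replicate] at h0 h1
  rcases eq_of_zero_or_ofBracket_eq_zero (𝕂 := 𝕂) (b := b) (by simpa using h1) with e | e
  · rw [e] at h0
    simp [letterCount, bracketWeight] at h0
    omega
  · rw [e] at h'; simp at h'

theorem bracketSeries_zerosOne {B : Set (FreeMagma (Fin 2))} (hB : IsMonomialBasis 𝕂 B)
    (had : ∀ k, adBracket k ∈ B) (ζ : FreeMagma (Fin 2) → 𝕂) (n : ℕ) :
    bracketSeries B ζ (zerosOne n) = ζ (adBracket n) := by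
  rw [coeff_bracketSeries, finsum_eq_single _ ⟨adBracket n, had n⟩]
  · rw [coeff_adBracket_zerosOne, mul_one]
  · intro b hb
    by_contra h
    have h' := right_ne_zero_of_mul h
    have h0 := letterCount_of_coeff_ne_zero h' 0
    have h1 := letterCount_of_coeff_ne_zero h' 1
    simp [wordWeight, zerosOne] at h0 h1
    have e := eq_adBracket hB had b.2 h1
    rw [h0] at e
    exact hb (Subtype.ext e)

/-! ### The coefficients of an exponential on the words `0^n 1` -/

theorem coeff_mul_zerosOne_of_forall {U T : NCSeries 𝕂 (Fin 2)}
    (hU : ∀ j, coeff (List.replicate (j + 1) 0) U = 0) (n : ℕ) :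
    coeff (zerosOne n) (U * T) =
      coeff [] U * coeff (zerosOne n) T + coeff (zerosOne n) U * coeff [] T := by
  induction n generalizing U with
  | zero => rw [zerosOne_zero, coeff_mul_cons, coeff_mul_nil, coeff_leftDeriv]
  | succ n ih =>
    rw [zerosOne_succ, coeff_mul_cons, ih fun j => hU (j + 1), coeff_leftDeriv, coeff_leftDeriv,
      show coeff [0] U = 0 from hU 0, zero_mul, zero_add]

theorem coeff_mul_zerosOne_succ {S T : NCSeries 𝕂 (Fin 2)}
    (hS : ∀ j, j ≠ 1 → coeff (List.replicate j 0) S = 0) (n : ℕ) :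
    coeff (zerosOne (n + 1)) (S * T) =
      coeff [0] S * coeff (zerosOne n) T + coeff (zerosOne (n + 1)) S * coeff [] T := by
  rw [zerosOne_succ, coeff_mul_cons, show coeff [] S = 0 from hS 0 (by omega), zero_mul, zero_add,
    coeff_mul_zerosOne_of_forall fun j => hS (j + 2) (by omega)]
  rfl

theorem coeff_pow_nil {S : NCSeries 𝕂 (Fin 2)} (hS : coeff [] S = 0) (m : ℕ) :
    coeff [] (S ^ (m + 1)) = 0 := by
  rw [pow_succ, coeff_mul_nil, hS, mul_zero]

/-- Cut the word into `m+1` pieces. A piece without the letter 1 contributes only if it is exactly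
`[0]`, so the last piece contains the 1 and the first `m` pieces are `[0]`. -/
theorem coeff_pow_zerosOne {S : NCSeries 𝕂 (Fin 2)}
    (hS : ∀ j, j ≠ 1 → coeff (List.replicate j 0) S = 0) (m n : ℕ) :
    coeff (zerosOne (m + n)) (S ^ (m + 1)) = coeff [0] S ^ m * coeff (zerosOne n) S := by
  induction m with
  | zero => simp
  | succ m ih =>
    rw [pow_succ' S, show m + 1 + n = (m + n) + 1 by omega, coeff_mul_zerosOne_succ hS, ih,
      coeff_pow_nil (hS 0 (by omega)), mul_zero, add_zero, pow_succ']
    ring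

theorem coeff_exp_zerosOne {S : NCSeries 𝕂 (Fin 2)}
    (hS : ∀ j, j ≠ 1 → coeff (List.replicate j 0) S = 0) (n : ℕ) :
    coeff (zerosOne n) (exp S) = ∑ m ∈ Finset.range (n + 1),
      (((m + 1).factorial : 𝕂))⁻¹ * (coeff [0] S ^ m * coeff (zerosOne (n - m)) S) := by
  have h1 : S ∈ order 𝕂 (Fin 2) 1 := mem_order_one.mpr (hS 0 (by omega))
  rw [coeff_exp h1 (length_zerosOne n).le, expSum, Finset.sum_range_succ', map_add, map_sum]
  have h0 : coeff (zerosOne n) (((Nat.factorial 0 : ℕ) : 𝕂)⁻¹ • S ^ 0) = 0 := by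
    cases n with
    | zero => simp [zerosOne_zero, coeff_one_cons]
    | succ n => simp [zerosOne_succ, coeff_one_cons]
  rw [h0, add_zero]
  refine Finset.sum_congr rfl fun m hm => ?_
  have hm : m ≤ n := by simpa [Nat.lt_succ_iff] using hm
  rw [map_smul, smul_eq_mul, ← coeff_pow_zerosOne hS, Nat.add_sub_cancel' hm]

/-! ### The coordinates of the first kind along `ad_{X_0}^k(X_1)` for the control `u(t) = t` -/

theorem chenRev_replicate (n : ℕ) :
    chenRev 𝕂 ![1, 2] (List.replicate n 0) = ((n.factorial : 𝕂))⁻¹ := by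
  induction n with
  | zero => simp [chenRev]
  | succ n ih =>
    have : wordWeight ![1, 2] (0 :: List.replicate n 0) = n + 1 := by simp [wordWeight, add_comm]
    rw [List.replicate_succ, chenRev, ih, this, Nat.factorial_succ]
    push_cast
    rw [mul_inv, div_eq_mul_inv, mul_comm]

theorem chen_zerosOne (t : 𝕂) (n : ℕ) :
    chen ![1, 2] t (zerosOne n) = ((n.factorial : 𝕂))⁻¹ / ((n + 2 : ℕ) : 𝕂) * t ^ (n + 2) := by
  have h : wordWeight ![1, 2] (List.replicate n (0 : Fin 2)) = n := by simp [wordWeight]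
  rw [zerosOne, chen_append, chen, List.reverse_replicate, chenRev_replicate, h]
  simp only [Matrix.cons_val_one, Matrix.cons_val_fin_one, pow_add]
  ring

/-- This is `∑_{k<n+2} C(n+2,k) B'_k = n+2` without its term `k = 0`, reversed by `m = n+1-k` and
divided by `(n+2)!`. The convention `B'_1 = +1/2` is the one that matches. -/
theorem sum_bernoulli'_div_factorial (n : ℕ) :
    ∑ m ∈ Finset.range (n + 1), (((m + 1).factorial : ℚ))⁻¹ *
      (bernoulli' (n - m + 1) / ((n - m + 1).factorial : ℚ)) =
      ((n.factorial : ℚ))⁻¹ / ((n + 2 : ℕ) : ℚ) := by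
  have h := sum_bernoulli' (n + 2)
  rw [Finset.sum_range_succ', ← Finset.sum_range_reflect] at h
  simp only [Nat.choose_zero_right, Nat.cast_one, bernoulli'_zero, mul_one] at h
  have hf : ((n + 2).factorial : ℚ) ≠ 0 := by exact_mod_cast Nat.factorial_ne_zero _
  have h2 : ∑ m ∈ Finset.range (n + 1), (((m + 1).factorial : ℚ))⁻¹ *
      (bernoulli' (n - m + 1) / ((n - m + 1).factorial : ℚ)) = ((n + 2).factorial : ℚ)⁻¹ *
      ∑ j ∈ Finset.range (n + 1), ((n + 2).choose (n + 1 - 1 - j + 1) : ℚ) *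
        bernoulli' (n + 1 - 1 - j + 1) := by
    rw [Finset.mul_sum]
    refine Finset.sum_congr rfl fun m hm => ?_
    have hm : m ≤ n := by simpa [Nat.lt_succ_iff] using hm
    rw [Nat.add_sub_cancel]
    have hc := Nat.choose_mul_factorial_mul_factorial (show n - m + 1 ≤ n + 2 by omega)
    rw [show n + 2 - (n - m + 1) = m + 1 by omega] at hc
    have hc : ((n + 2).choose (n - m + 1) : ℚ) * (n - m + 1).factorial * (m + 1).factorial =
        (n + 2).factorial := by exact_mod_cast hc
    have h1 : ((m + 1).factorial : ℚ) ≠ 0 := by exact_mod_cast Nat.factorial_ne_zero _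
    have h3 : ((n - m + 1).factorial : ℚ) ≠ 0 := by exact_mod_cast Nat.factorial_ne_zero _
    field_simp
    rw [← hc]; ring
  rw [h2, eq_sub_of_add_eq h, Nat.factorial_succ, Nat.factorial_succ]
  push_cast
  have h1 : (n.factorial : ℚ) ≠ 0 := by exact_mod_cast Nat.factorial_ne_zero _
  have h3 : (n : ℚ) + 1 ≠ 0 := by positivity
  have h4 : (n : ℚ) + 1 + 1 ≠ 0 := by positivity
  have h5 : (n : ℚ) + 2 ≠ 0 := by positivity
  field_simp
  ring

theorem coord_adBracket {B : Set (FreeMagma (Fin 2))} (hB : IsMonomialBasis 𝕂 B)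
    (had : ∀ k, adBracket k ∈ B) {a : Fin 2 → ℝ → 𝕂}
    (ha : ∀ i τ, a i τ = (τ : 𝕂) ^ ((![1, 2] : Fin 2 → ℕ) i - 1)) {t : ℝ}
    {ζ : FreeMagma (Fin 2) → 𝕂} (hζ : IsFirstKindAt B a t ζ) (n : ℕ) :
    ζ (adBracket n) =
      (t : 𝕂) ^ (n + 2) * ((bernoulli' (n + 1) / ((n + 1).factorial : ℚ) : ℚ) : 𝕂) := by
  have hw : ∀ i, 0 < (![1, 2] : Fin 2 → ℕ) i := by intro i; fin_cases i <;> simp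
  have hexp : chen ![1, 2] (t : 𝕂) = fsExp (bracketSeries B ζ) := by
    -- The initial datum 1 isolates the exponential.
    have h := hζ fsOne
    rw [formalSolution_eq hw _ ha] at h
    funext σ
    have := congrFun h σ
    rwa [fsOne_fsMul, fsOne_fsMul] at this
  set S : NCSeries 𝕂 (Fin 2) := ofFun (bracketSeries B ζ) with hSdef
  have hS : ∀ j, j ≠ 1 → coeff (List.replicate j 0) S = 0 := fun j hj =>
    bracketSeries_replicate B ζ hj
  have hSz : ∀ k, coeff (zerosOne k) S = ζ (adBracket k) := bracketSeries_zerosOne hB had ζ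
  have hcoeff : ∀ σ, coeff σ (exp S) = chen ![1, 2] (t : 𝕂) σ := fun σ => (congrFun hexp σ).symm
  have hs : coeff [0] S = (t : 𝕂) := by
    have h := hcoeff [0]
    rw [coeff_exp (N := 1) (mem_order_one.mpr (hS 0 (by omega))) (by simp)] at h
    simpa [expSum, Finset.sum_range_succ, coeff_one_cons, chen, chenRev, wordWeight] using h
  induction n using Nat.strong_induction_on with
  | _ n ih =>
    have h := hcoeff (zerosOne n)
    rw [coeff_exp_zerosOne hS, chen_zerosOne, hs] at h
    have hb := congrArg (fun q : ℚ => (q : 𝕂) * (t : 𝕂) ^ (n + 2)) (sum_bernoulli'_div_factorial n)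
    simp only [Rat.cast_sum, Finset.sum_mul] at hb
    have hb' : (((n.factorial : ℚ)⁻¹ / ((n + 2 : ℕ) : ℚ) : ℚ) : 𝕂) =
      ((n.factorial : 𝕂))⁻¹ / ((n + 2 : ℕ) : 𝕂) := by push_cast; rfl
    -- Both convolutions are split at `m = 0`, which alone involves index `n`; the other terms agree
    -- by induction.
    rw [hb', ← h, Finset.sum_range_succ', Finset.sum_range_succ'] at hb
    rw [Finset.sum_congr rfl fun m hm => ?_] at hb
    · have := add_left_cancel hb
      simp only [hSz] at this
      simpa [mul_comm] using this.symm
    · have hm : m < n := by simpa using hm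
      rw [hSz, ih (n - (m + 1)) (by omega)]
      have e : (t : 𝕂) ^ (n + 2) = (t : 𝕂) ^ (m + 1) * (t : 𝕂) ^ (n - (m + 1) + 2) := by
        rw [← pow_add]; congr 1; omega
      rw [e]
      push_cast
      ring

theorem firstKindCoord_adBracket {B : Set (FreeMagma (Fin 2))} (hB : IsMonomialBasis 𝕂 B)
    (had : ∀ k, adBracket k ∈ B) (t : ℝ) (n : ℕ) :
    firstKindCoord B (affineInput fun τ : ℝ => (τ : 𝕂)) t (adBracket n) =
      (t : 𝕂) ^ (n + 2) * ((bernoulli' (n + 1) / ((n + 1).factorial : ℚ) : ℚ) : 𝕂) := by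
  have hw : ∀ i, 0 < (![1, 2] : Fin 2 → ℕ) i := by intro i; fin_cases i <;> simp
  have ha : ∀ i τ, affineInput (fun τ : ℝ => (τ : 𝕂)) i τ =
      (τ : 𝕂) ^ ((![1, 2] : Fin 2 → ℕ) i - 1) := by
    intro i τ; fin_cases i <;> simp [affineInput]
  have hex := exists_isFirstKindAt hw ha hB t
  rw [firstKindCoord, dif_pos hex]
  exact coord_adBracket hB had ha hex.choose_spec n

end NCSeries

/-! ### The vector fields `x₂ e₁` and `e₂ / (1 - x₁)` -/

section VectorFields

variable {𝕂 : Type} [RCLike 𝕂]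

/-- A coordinate, as a real-linear form. -/
noncomputable def coordCLM (𝕂 : Type) [RCLike 𝕂] (j : Fin 2) : StateSpace 𝕂 2 →L[ℝ] 𝕂 :=
  (EuclideanSpace.proj j : StateSpace 𝕂 2 →L[𝕂] 𝕂).restrictScalars ℝ

theorem coordCLM_apply (j : Fin 2) (x : StateSpace 𝕂 2) : coordCLM 𝕂 j x = x j := rfl

/-- The domain of the vector field `e₂ / (1 - x₁)`. -/
def regularSet (𝕂 : Type) [RCLike 𝕂] : Set (StateSpace 𝕂 2) := {x | 1 - x 0 ≠ 0}

theorem isOpen_regularSet : IsOpen (regularSet 𝕂) := by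
  have h : Continuous fun x : StateSpace 𝕂 2 => 1 - coordCLM 𝕂 0 x := by fun_prop
  exact isOpen_ne_fun h continuous_const

theorem norm_apply_le {δ : ℝ} {x : StateSpace 𝕂 2} (hx : x ∈ Metric.closedBall 0 δ) (j : Fin 2) :
    ‖x j‖ ≤ δ := (PiLp.norm_apply_le x j).trans (by simpa using hx)

theorem le_norm_one_sub {δ : ℝ} {x : StateSpace 𝕂 2} (hx : x ∈ Metric.closedBall 0 δ) :
    1 - δ ≤ ‖1 - x 0‖ := by
  have h1 := norm_sub_norm_le (1 : 𝕂) (x 0)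
  have h2 := norm_apply_le hx 0
  rw [norm_one] at h1
  linarith

theorem closedBall_subset_regularSet {δ : ℝ} (hδ : δ < 1) :
    Metric.closedBall 0 δ ⊆ regularSet 𝕂 := by
  intro x hx h
  have := le_norm_one_sub hx
  rw [h, norm_zero] at this
  linarith

/-- The case `k = 0` serves the derivatives of `1/(1 - x_1)`, the case `k = n` the iterated
brackets. The factor `k` makes the truncated exponent `k - 1` harmless. -/
theorem hasFDerivAt_pow_div (c : 𝕂) (k n : ℕ) {x : StateSpace 𝕂 2} (hx : x ∈ regularSet 𝕂) :
    HasFDerivAt (fun y : StateSpace 𝕂 2 => c * y 1 ^ k / (1 - y 0) ^ (n + 1))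
      ((c * x 1 ^ k * ((n + 1) / (1 - x 0) ^ (n + 2))) • coordCLM 𝕂 0 +
        (c * (k * x 1 ^ (k - 1)) / (1 - x 0) ^ (n + 1)) • coordCLM 𝕂 1) x := by
  have hx : 1 - x 0 ≠ 0 := hx
  have h1 : HasDerivAt (fun z : 𝕂 => c * z ^ k) (c * (k * x 1 ^ (k - 1))) (coordCLM 𝕂 1 x) :=
    (hasDerivAt_pow k (x 1)).const_mul c
  have h2 : HasDerivAt (fun z : 𝕂 => ((1 - z) ^ (n + 1))⁻¹) ((n + 1) / (1 - x 0) ^ (n + 2))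
      (coordCLM 𝕂 0 x) := by
    have h := (((hasDerivAt_id (x 0)).const_sub 1).pow (n + 1)).inv (pow_ne_zero _ hx)
    refine h.congr_deriv ?_
    change -(((n + 1 : ℕ) : 𝕂) * (1 - x 0) ^ n * -1) / ((1 - x 0) ^ (n + 1)) ^ 2 = _
    push_cast
    field_simp
    ring
  have h1' := h1.comp_hasFDerivAt x (coordCLM 𝕂 1).hasFDerivAt
  have h2' := h2.comp_hasFDerivAt x (coordCLM 𝕂 0).hasFDerivAt
  have e : (fun y : StateSpace 𝕂 2 => c * y 1 ^ k / (1 - y 0) ^ (n + 1)) =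
      ((fun z => c * z ^ k) ∘ coordCLM 𝕂 1) * ((fun z => ((1 - z) ^ (n + 1))⁻¹) ∘ coordCLM 𝕂 0) :=
    funext fun y => div_eq_mul_inv _ _
  rw [e]
  refine (h1'.mul h2').congr_fderiv ?_
  ext v
  simp [coordCLM_apply]
  ring

/-! ### Bounds on partial derivatives and finiteness of the analytic norm. -/

theorem norm_single_apply_le {c : 𝕂} (hc : ‖c‖ ≤ 1) (i j : Fin 2) :
    ‖(EuclideanSpace.single i c : StateSpace 𝕂 2) j‖ ≤ 1 := by
  rw [PiLp.single_apply]
  split_ifs <;> simp [hc]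

theorem norm_I_le_one : ‖(RCLike.I : 𝕂)‖ ≤ 1 := by
  rw [RCLike.norm_I]; split_ifs <;> simp

/-- The functions `c / (1 - x₁)^(n+1)` with `|c| ≤ n!`. -/
def IsInvPow (n : ℕ) (g : StateSpace 𝕂 2 → 𝕂) : Prop :=
  ∃ c : 𝕂, ‖c‖ ≤ n.factorial ∧ ∀ x ∈ regularSet 𝕂, g x = c / (1 - x 0) ^ (n + 1)

/-- The functions `c x₂ + d` with `|c|, |d| ≤ 1`. -/
def IsAffineFun (g : StateSpace 𝕂 2 → 𝕂) : Prop :=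
  ∃ c d : 𝕂, ‖c‖ ≤ 1 ∧ ‖d‖ ≤ 1 ∧ ∀ x, g x = c * x 1 + d

/-- Even when `𝕂 = ℂ` the real differential is `𝕂`-linear here, so differentiating along `i e_1`
only multiplies the constant by `i`. -/
theorem IsInvPow.realDirDeriv {n : ℕ} {g : StateSpace 𝕂 2 → 𝕂} (hg : IsInvPow n g)
    {v : StateSpace 𝕂 2} (hv : ∀ j, ‖v j‖ ≤ 1) : IsInvPow (n + 1) (realDirDeriv v g) := by
  obtain ⟨c, hc, h⟩ := hg
  refine ⟨c * (n + 1) * v 0, ?_, fun x hx => ?_⟩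
  · rw [norm_mul, norm_mul, Nat.factorial_succ]
    have e : ‖(n + 1 : 𝕂)‖ = n + 1 := by
      rw [← Nat.cast_succ, RCLike.norm_natCast, Nat.cast_succ]
    rw [e]
    push_cast
    calc ‖c‖ * (n + 1) * ‖v 0‖ ≤ n.factorial * (n + 1) * 1 := by
          gcongr; exact hv 0
      _ = (n + 1) * n.factorial := by ring
  · have h1 := hasFDerivAt_pow_div c 0 n hx
    have h2 : g =ᶠ[𝓝 x] fun y : StateSpace 𝕂 2 => c * y 1 ^ 0 / (1 - y 0) ^ (n + 1) := by
      filter_upwards [isOpen_regularSet.mem_nhds hx] with y hy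
      rw [h y hy, pow_zero, mul_one]
    rw [_root_.realDirDeriv, (h1.congr_of_eventuallyEq h2).fderiv]
    simp [coordCLM_apply]
    ring

theorem IsAffineFun.realDirDeriv {g : StateSpace 𝕂 2 → 𝕂} (hg : IsAffineFun g)
    {v : StateSpace 𝕂 2} (hv : ∀ j, ‖v j‖ ≤ 1) : IsAffineFun (realDirDeriv v g) := by
  obtain ⟨c, d, hc, -, h⟩ := hg
  refine ⟨0, c * v 1, by simp, ?_, fun x => ?_⟩
  · rw [norm_mul]; exact mul_le_one₀ hc (norm_nonneg _) (hv 1)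
  · have h1 : HasFDerivAt g (c • coordCLM 𝕂 1) x := by
      rw [show g = fun y => c * coordCLM 𝕂 1 y + d from funext h]
      exact ((coordCLM 𝕂 1).hasFDerivAt.const_mul c).add_const d
    rw [_root_.realDirDeriv, h1.fderiv]
    simp [coordCLM_apply]

/-- Iterated partial derivatives respect a scale of classes of functions. -/
theorem realPartial_induction {C : ℕ → (StateSpace 𝕂 2 → 𝕂) → Prop}
    (hC : ∀ n g v, (∀ j, ‖v j‖ ≤ 1) → C n g → C (n + 1) (realDirDeriv v g))
    {g : StateSpace 𝕂 2 → 𝕂} (hg : C 0 g) (α : Fin 2 × Fin 2 → ℕ) :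
    C (∑ p, α p) (realPartial α g) := by
  have hit : ∀ (m n : ℕ) (g : StateSpace 𝕂 2 → 𝕂) (v : StateSpace 𝕂 2), (∀ j, ‖v j‖ ≤ 1) →
      C n g → C (n + m) ((realDirDeriv v)^[m] g) := by
    intro m n g v hv h
    induction m with
    | zero => exact h
    | succ m ih => rw [Function.iterate_succ_apply']; exact hC _ _ _ hv ih
  have h1 : ∀ i j : Fin 2, ‖(EuclideanSpace.single i (1 : 𝕂) : StateSpace 𝕂 2) j‖ ≤ 1 :=
    norm_single_apply_le (by simp)
  have hI : ∀ i j : Fin 2, ‖(EuclideanSpace.single i (RCLike.I : 𝕂) : StateSpace 𝕂 2) j‖ ≤ 1 :=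
    norm_single_apply_le norm_I_le_one
  have h := hit (α (0, 0)) _ _ _ (h1 0) (hit (α (0, 1)) _ _ _ (hI 0)
    (hit (α (1, 0)) _ _ _ (h1 1) (hit (α (1, 1)) _ _ _ (hI 1) hg)))
  have e : ∑ p, α p = 0 + α (1, 1) + α (1, 0) + α (0, 1) + α (0, 0) := by
    rw [Fintype.sum_prod_type]; simp only [Fin.sum_univ_two]; ring
  rw [e]
  exact h

theorem IsInvPow.supBall_le {n : ℕ} {g : StateSpace 𝕂 2 → 𝕂} (hg : IsInvPow n g) :
    supBall (1 / 8) g ≤ ENNReal.ofReal (n.factorial * (8 / 7) ^ (n + 1)) := by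
  obtain ⟨c, hc, h⟩ := hg
  refine iSup₂_le fun x hx => ?_
  rw [h x (closedBall_subset_regularSet (by norm_num) hx), ← ofReal_norm]
  refine ENNReal.ofReal_le_ofReal ?_
  have h1 := le_norm_one_sub hx
  rw [norm_div, norm_pow, div_eq_mul_inv, ← inv_pow]
  gcongr
  rw [inv_le_comm₀ (by linarith) (by norm_num)]
  linarith

theorem IsAffineFun.supBall_le {g : StateSpace 𝕂 2 → 𝕂} (hg : IsAffineFun g) :
    supBall (1 / 8) g ≤ ENNReal.ofReal 2 := by
  obtain ⟨c, d, hc, hd, h⟩ := hg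
  refine iSup₂_le fun x hx => ?_
  rw [h x, ← ofReal_norm]
  refine ENNReal.ofReal_le_ofReal ?_
  have h1 := norm_apply_le hx 1
  calc ‖c * x 1 + d‖ ≤ ‖c‖ * ‖x 1‖ + ‖d‖ := (norm_add_le _ _).trans (by rw [norm_mul])
    _ ≤ 1 * 1 + 1 := by gcongr; linarith
    _ = 2 := by norm_num

theorem tsum_fin_two_arrow {α : Type*} (h : α → ENNReal) :
    ∑' f : Fin 2 → α, h (f 0) * h (f 1) = (∑' a, h a) * ∑' a, h a := by
  rw [← (finTwoArrowEquiv α).symm.tsum_eq, ENNReal.tsum_prod']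
  simp [finTwoArrowEquiv, ENNReal.tsum_mul_left, ENNReal.tsum_mul_right]

/-- The sum factors into four geometric series, one for each entry of the multi-index. -/
theorem tsum_pow_multiindex_lt_top {q : ℝ} (hq0 : 0 ≤ q) (hq : q < 1) :
    ∑' α : Fin 2 × Fin 2 → ℕ, ENNReal.ofReal (2 * q ^ ∑ p, α p) < ⊤ := by
  have h1 : ∑' n : ℕ, ENNReal.ofReal (q ^ n) ≠ ⊤ := by
    rw [← ENNReal.ofReal_tsum_of_nonneg (fun n => pow_nonneg hq0 n)
      (summable_geometric_of_lt_one hq0 hq)]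
    exact ENNReal.ofReal_ne_top
  have h2 : ∀ α : Fin 2 × Fin 2 → ℕ, ENNReal.ofReal (2 * q ^ ∑ p, α p) = ENNReal.ofReal 2 *
      ((ENNReal.ofReal (q ^ Equiv.curry _ _ _ α 0 0) * ENNReal.ofReal (q ^ Equiv.curry _ _ _ α 0 1)) *
      (ENNReal.ofReal (q ^ Equiv.curry _ _ _ α 1 0) *
        ENNReal.ofReal (q ^ Equiv.curry _ _ _ α 1 1))) := by
    intro α
    rw [Fintype.sum_prod_type]
    simp only [Fin.sum_univ_two, Equiv.curry_apply, Function.curry_apply]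
    rw [← ENNReal.ofReal_mul (by positivity), ← ENNReal.ofReal_mul (by positivity),
      ← ENNReal.ofReal_mul (by positivity), ← ENNReal.ofReal_mul (by positivity)]
    simp only [pow_add]
  simp_rw [h2]
  rw [ENNReal.tsum_mul_left, (Equiv.curry (Fin 2) (Fin 2) ℕ).tsum_eq fun β : Fin 2 → Fin 2 → ℕ =>
    (ENNReal.ofReal (q ^ β 0 0) * ENNReal.ofReal (q ^ β 0 1)) *
      (ENNReal.ofReal (q ^ β 1 0) * ENNReal.ofReal (q ^ β 1 1)),
    tsum_fin_two_arrow fun b : Fin 2 → ℕ => ENNReal.ofReal (q ^ b 0) * ENNReal.ofReal (q ^ b 1),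
    tsum_fin_two_arrow fun n : ℕ => ENNReal.ofReal (q ^ n)]
  exact (ENNReal.mul_ne_top ENNReal.ofReal_ne_top
    (ENNReal.mul_ne_top (ENNReal.mul_ne_top h1 h1) (ENNReal.mul_ne_top h1 h1))).lt_top

theorem factorial_add_le (a b : ℕ) :
    (a + b).factorial ≤ 2 ^ (a + b) * (a.factorial * b.factorial) := by
  rw [← Nat.add_choose_mul_factorial_mul_factorial, mul_assoc]
  exact Nat.mul_le_mul_right _ (Nat.choose_le_two_pow _ _)

/-- Two rounds of the bound `2^n` on binomial coefficients. -/
theorem factorial_sum_le (α : Fin 2 × Fin 2 → ℕ) :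
    (∑ p, α p).factorial ≤ 4 ^ (∑ p, α p) * ∏ p, (α p).factorial := by
  rw [Fintype.sum_prod_type, Fintype.prod_prod_type]
  simp only [Fin.sum_univ_two, Fin.prod_univ_two]
  generalize α (0, 0) = a
  generalize α (0, 1) = b
  generalize α (1, 0) = c
  generalize α (1, 1) = d
  calc (a + b + (c + d)).factorial
      ≤ 2 ^ (a + b + (c + d)) * ((a + b).factorial * (c + d).factorial) := factorial_add_le _ _
    _ ≤ 2 ^ (a + b + (c + d)) * ((2 ^ (a + b) * (a.factorial * b.factorial)) *
        (2 ^ (c + d) * (c.factorial * d.factorial))) := by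
      gcongr <;> exact factorial_add_le _ _
    _ = 4 ^ (a + b + (c + d)) * (a.factorial * b.factorial * (c.factorial * d.factorial)) := by
      rw [show (4 : ℕ) = 2 * 2 by norm_num, mul_pow, pow_add 2 (a + b) (c + d)]
      ring

theorem analyticNorm_lt_top {f : StateSpace 𝕂 2 → StateSpace 𝕂 2}
    (hf : ∀ j, IsInvPow 0 (fun x => f x j) ∨ IsAffineFun (fun x => f x j)) :
    analyticNorm (1 / 8) (1 / 8) f < ⊤ := by
  refine ENNReal.sum_lt_top.mpr fun j _ => ?_
  -- The ratio is `4/7 = (1/8)·4·(8/7)`: the radius, the multinomial bound, and the bound on `1/|1 -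
  -- x_1|` over the ball. The prefactor 2 covers both `8/7` and the bound for affine components.
  refine lt_of_le_of_lt (ENNReal.tsum_le_tsum fun α => ?_)
    (tsum_pow_multiindex_lt_top (q := 4 / 7) (by norm_num) (by norm_num))
  set n := ∑ p, α p with hn
  have hP : (1 : ℝ) ≤ ∏ p, ((α p).factorial : ℝ) := by
    exact_mod_cast Finset.one_le_prod' fun p _ => Nat.one_le_iff_ne_zero.mpr (α p).factorial_ne_zero
  have hP' : (n.factorial : ℝ) ≤ 4 ^ n * ∏ p, ((α p).factorial : ℝ) := by
    exact_mod_cast factorial_sum_le α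
  rcases hf j with h | h
  · have h1 := realPartial_induction (C := IsInvPow) (fun _ _ _ hv h => h.realDirDeriv hv) h α
    refine (mul_le_mul_right h1.supBall_le _).trans ?_
    rw [← ENNReal.ofReal_mul (by positivity), ← hn]
    refine ENNReal.ofReal_le_ofReal ?_
    rw [div_mul_eq_mul_div, div_le_iff₀ (by positivity)]
    calc (1 / 8 : ℝ) ^ n * (n.factorial * (8 / 7) ^ (n + 1))
        ≤ (1 / 8 : ℝ) ^ n * ((4 ^ n * ∏ p, ((α p).factorial : ℝ)) * (8 / 7) ^ (n + 1)) := by gcongr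
      _ = (8 / 7) * (4 / 7) ^ n * ∏ p, ((α p).factorial : ℝ) := by
        rw [pow_succ, show (4 / 7 : ℝ) = 1 / 8 * 4 * (8 / 7) by norm_num, mul_pow, mul_pow]
        ring
      _ ≤ 2 * (4 / 7) ^ n * ∏ p, ((α p).factorial : ℝ) := by gcongr; norm_num
  · have h1 := realPartial_induction (C := fun _ => IsAffineFun)
      (fun _ _ _ hv h => h.realDirDeriv hv) h α
    refine (mul_le_mul_right h1.supBall_le _).trans ?_
    rw [← ENNReal.ofReal_mul (by positivity)]
    refine ENNReal.ofReal_le_ofReal ?_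
    rw [div_mul_eq_mul_div, div_le_iff₀ (by positivity)]
    calc (1 / 8 : ℝ) ^ n * 2 ≤ (4 / 7) ^ n * 2 := by gcongr <;> norm_num
      _ ≤ 2 * (4 / 7) ^ n * ∏ p, ((α p).factorial : ℝ) := by
        rw [mul_comm]; exact le_mul_of_one_le_right (by positivity) hP

/-! ### The two fields, their iterated brackets and their regularity. -/

/-- The vector field `x₂ e₁`. -/
noncomputable def driftField (𝕂 : Type) [RCLike 𝕂] : StateSpace 𝕂 2 → StateSpace 𝕂 2 :=
  fun x => x 1 • EuclideanSpace.single 0 (1 : 𝕂)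

/-- The vector field `e₂ / (1 - x₁)`. -/
noncomputable def controlField (𝕂 : Type) [RCLike 𝕂] : StateSpace 𝕂 2 → StateSpace 𝕂 2 :=
  fun x => (1 / (1 - x 0)) • EuclideanSpace.single 1 (1 : 𝕂)

theorem contDiff_driftField : ContDiff ℝ ∞ (driftField 𝕂) := by
  have h : ContDiff ℝ ∞ fun x : StateSpace 𝕂 2 => coordCLM 𝕂 1 x := (coordCLM 𝕂 1).contDiff
  exact h.smul contDiff_const

theorem contDiffOn_controlField : ContDiffOn ℝ ∞ (controlField 𝕂) (regularSet 𝕂) := by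
  have h1 : ContDiffOn ℝ ∞ (fun x : StateSpace 𝕂 2 => 1 - coordCLM 𝕂 0 x) (regularSet 𝕂) :=
    contDiffOn_const.sub (coordCLM 𝕂 0).contDiff.contDiffOn
  have h : ContDiffOn ℝ ∞ (fun x : StateSpace 𝕂 2 => 1 / (1 - coordCLM 𝕂 0 x)) (regularSet 𝕂) := by
    simp only [one_div]
    exact h1.inv fun _ hx => hx
  exact h.smul contDiffOn_const

theorem adField_succ (f g : StateSpace 𝕂 2 → StateSpace 𝕂 2) (k : ℕ) :
    adField f g (k + 1) = VectorField.lieBracket ℝ f (adField f g k) :=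
  Function.iterate_succ_apply' _ _ _

theorem contDiffOn_adField (k : ℕ) :
    ContDiffOn ℝ ∞ (adField (driftField 𝕂) (controlField 𝕂) k) (regularSet 𝕂) := by
  induction k with
  | zero => exact contDiffOn_controlField
  | succ k ih =>
    rw [adField_succ]
    have hf : ContDiffOn ℝ ∞ (driftField 𝕂) (regularSet 𝕂) := contDiff_driftField.contDiffOn
    exact ((ih.fderiv_of_isOpen isOpen_regularSet (m := ∞) (by simp)).clm_apply hf).sub
      ((hf.fderiv_of_isOpen isOpen_regularSet (m := ∞) (by simp)).clm_apply ih)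

theorem fderiv_apply_coord {f : StateSpace 𝕂 2 → StateSpace 𝕂 2} {x : StateSpace 𝕂 2}
    (hf : DifferentiableAt ℝ f x) (v : StateSpace 𝕂 2) (j : Fin 2) :
    (fderiv ℝ f x v) j = fderiv ℝ (fun y => f y j) x v := by
  have h := (coordCLM 𝕂 j).hasFDerivAt.comp x hf.hasFDerivAt
  have e : (coordCLM 𝕂 j ∘ f) = fun y => f y j := rfl
  rw [e] at h
  rw [h.fderiv]
  rfl

/-- The second component of `f_0` vanishes, so on second components the bracket with `f_0` is just
`x_2 ∂/∂x_1`, which does not differentiate `x_2`. -/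
theorem adField_apply_one (k : ℕ) {x : StateSpace 𝕂 2} (hx : x ∈ regularSet 𝕂) :
    adField (driftField 𝕂) (controlField 𝕂) k x 1 =
      (k.factorial : 𝕂) * x 1 ^ k / (1 - x 0) ^ (k + 1) := by
  induction k generalizing x with
  | zero => simp [adField, controlField]
  | succ k ih =>
    have hd : DifferentiableAt ℝ (adField (driftField 𝕂) (controlField 𝕂) k) x :=
      ((contDiffOn_adField k).contDiffAt (isOpen_regularSet.mem_nhds hx)).differentiableAt (by simp)
    have hd0 : DifferentiableAt ℝ (driftField 𝕂) x :=
      contDiff_driftField.contDiffAt.differentiableAt (by simp)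
    have h2 : (fun y => adField (driftField 𝕂) (controlField 𝕂) k y 1) =ᶠ[𝓝 x]
        fun y : StateSpace 𝕂 2 => (k.factorial : 𝕂) * y 1 ^ k / (1 - y 0) ^ (k + 1) := by
      filter_upwards [isOpen_regularSet.mem_nhds hx] with y hy using ih hy
    have h3 : (fun y => driftField 𝕂 y 1) = fun _ => 0 := by
      funext y; simp [driftField]
    rw [adField_succ, VectorField.lieBracket, PiLp.sub_apply, fderiv_apply_coord hd,
      fderiv_apply_coord hd0, h3,
      ((hasFDerivAt_pow_div (k.factorial : 𝕂) k k hx).congr_of_eventuallyEq h2).fderiv]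
    simp [coordCLM_apply, driftField, Nat.factorial_succ]
    ring

theorem memCinfty_of_contDiffOn {f : StateSpace 𝕂 2 → StateSpace 𝕂 2}
    (hf : ContDiffOn ℝ ∞ f (regularSet 𝕂)) : MemCinfty (1 / 8) f := fun k =>
  ⟨regularSet 𝕂, isOpen_regularSet, closedBall_subset_regularSet (by norm_num),
    hf.of_le (by exact_mod_cast le_top)⟩

theorem memAnalytic_driftField : MemAnalytic (1 / 8) (1 / 8) (driftField 𝕂) := by
  refine ⟨memCinfty_of_contDiffOn contDiff_driftField.contDiffOn,
    analyticNorm_lt_top fun j => Or.inr ?_⟩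
  fin_cases j
  · exact ⟨1, 0, by simp, by simp, fun x => by simp [driftField]⟩
  · exact ⟨0, 0, by simp, by simp, fun x => by simp [driftField]⟩

theorem memAnalytic_controlField : MemAnalytic (1 / 8) (1 / 8) (controlField 𝕂) := by
  refine ⟨memCinfty_of_contDiffOn contDiffOn_controlField, analyticNorm_lt_top fun j => ?_⟩
  fin_cases j
  · exact Or.inr ⟨0, 0, by simp, by simp, fun x => by simp [controlField]⟩
  · exact Or.inl ⟨1, by simp, fun x _ => by simp [controlField]⟩

/-! ### Divergence -/

theorem enorm_le_ckNorm_zero {δ : ℝ} {f : StateSpace 𝕂 2 → StateSpace 𝕂 2} {x : StateSpace 𝕂 2}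
    (hx : x ∈ Metric.closedBall 0 δ) (j : Fin 2) : ‖f x j‖ₑ ≤ ckNorm 0 δ f := by
  have h1 : ‖f x j‖ₑ ≤ supBall δ (fun y => f y j) :=
    le_iSup₂ (f := fun y (_ : y ∈ Metric.closedBall (0 : StateSpace 𝕂 2) δ) => ‖f y j‖ₑ) x hx
  refine h1.trans (le_trans ?_ (Finset.single_le_sum (fun _ _ => zero_le) (Finset.mem_univ j)))
  refine le_trans ?_ (ENNReal.le_tsum ⟨0, by simp⟩)
  simp [realPartial, List.finRange_succ]

/-- Euler's formula for `ζ(2m+2)`, whose first term is already 1; the power `2^(2m+1)` in it is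
relaxed to `2^(2m+2)`. -/
theorem one_le_two_pi_pow_mul_bernoulli' (m : ℕ) :
    1 ≤ (2 * Real.pi) ^ (2 * m + 2) *
      |((bernoulli' (2 * m + 2) / ((2 * m + 2).factorial : ℚ) : ℚ) : ℝ)| := by
  have h := hasSum_zeta_nat (k := m + 1) (by omega)
  have h1 := le_hasSum h 1 fun j _ => by positivity
  rw [bernoulli_eq_bernoulli'_of_ne_one (by omega)] at h1
  rw [show 2 * (m + 1) = 2 * m + 2 by ring] at h1
  have h2 := h1.trans (le_abs_self _)
  simp only [Nat.cast_one, one_pow, div_one] at h2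
  refine h2.trans ?_
  have hpi := Real.pi_pos
  rw [mul_div_assoc, abs_mul, abs_mul, abs_mul, abs_pow, abs_neg, abs_one, one_pow, one_mul,
    abs_of_pos (by positivity : (0 : ℝ) < 2 ^ (2 * m + 2 - 1)),
    abs_of_pos (by positivity : (0 : ℝ) < Real.pi ^ (2 * m + 2)), mul_pow]
  push_cast
  gcongr
  · norm_num
  · omega

theorem not_tendsto_bernoulli'_mul_factorial {t r : ℝ} (ht : 0 < t) (hr : 0 < r) :
    ¬ Tendsto (fun n : ℕ => t ^ (n + 2) *
      |((bernoulli' (n + 1) / ((n + 1).factorial : ℚ) : ℚ) : ℝ)| * (n.factorial * r ^ n))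
      atTop (𝓝 0) := by
  intro h
  have hpi := Real.pi_pos
  set q : ℝ := t * r / (2 * Real.pi) with hq
  have hq0 : 0 < q := by positivity
  -- The quotient `q^(-n)/n!` tends to 0, so the product would too; yet it cancels the factorial and
  -- geometric growth exactly.
  have h1 := h.mul (FloorSemiring.tendsto_pow_div_factorial_atTop q⁻¹)
  -- Odd `n` make `n+1` even, where the lower bound on Bernoulli numbers is available.
  have hodd : Tendsto (fun m : ℕ => 2 * m + 1) atTop atTop :=
    tendsto_atTop_mono (fun m => by omega : ∀ m : ℕ, m ≤ 2 * m + 1) tendsto_id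
  have h2 := h1.comp hodd
  rw [mul_zero] at h2
  have h3 : t ^ 2 / (2 * Real.pi) ≤ 0 := by
    refine ge_of_tendsto' h2 fun m => ?_
    have hb := one_le_two_pi_pow_mul_bernoulli' m
    simp only [Function.comp]
    set b := |((bernoulli' (2 * m + 1 + 1) / ((2 * m + 1 + 1).factorial : ℚ) : ℚ) : ℝ)|
    have hb : 1 ≤ (2 * Real.pi) ^ (2 * m + 2) * b := hb
    have e : t ^ (2 * m + 1 + 2) * b * (((2 * m + 1).factorial : ℝ) * r ^ (2 * m + 1)) *
        (q⁻¹ ^ (2 * m + 1) / ((2 * m + 1).factorial : ℝ)) =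
        t ^ 2 / (2 * Real.pi) * ((2 * Real.pi) ^ (2 * m + 2) * b) := by
      have hf : ((2 * m + 1).factorial : ℝ) ≠ 0 := by exact_mod_cast Nat.factorial_ne_zero _
      rw [hq, inv_div, div_pow, mul_pow, pow_add t (2 * m + 1) 2, pow_succ _ (2 * m + 1)]
      field_simp
      ring
    rw [e]
    exact le_mul_of_one_le_right (by positivity) hb
  have : 0 < t ^ 2 / (2 * Real.pi) := by positivity
  linarith

end VectorFields

theorem mainTheorem12 (𝕂 : Type) [RCLike 𝕂] :
    ∃ (T δ : ℝ) (f₀ f₁ : StateSpace 𝕂 2 → StateSpace 𝕂 2) (u : ℝ → 𝕂),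
      T = 1 ∧ 0 < δ ∧
      f₀ = (fun x => x 1 • EuclideanSpace.single 0 (1 : 𝕂)) ∧
      f₁ = (fun x => (1 / (1 - x 0)) • EuclideanSpace.single 1 (1 : 𝕂)) ∧
      u = (fun t : ℝ => (t : 𝕂)) ∧
      MemAnalytic δ δ f₀ ∧ MemAnalytic δ δ f₁ ∧ f₀ 0 = 0 ∧
      ContDiffOn ℝ ∞ u (Set.Icc 0 T) ∧
      ∀ B : Set (FreeMagma (Fin 2)), IsMonomialBasis 𝕂 B →
        FreeMagma.of 0 ∈ B → (∀ k : ℕ, adBracket k ∈ B) →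
        ∀ t ∈ Set.Ioo (0 : ℝ) T,
          (∀ n : ℕ, MemCinfty δ (magnusLinearSum B f₀ f₁ u n t)) ∧
          ∀ δ' ∈ Set.Ioo (0 : ℝ) δ,
            ¬ ∃ G : StateSpace 𝕂 2 → StateSpace 𝕂 2, MemCk 0 δ' G ∧
              Tendsto (fun n : ℕ => ckNorm 0 δ' (fun x => magnusLinearSum B f₀ f₁ u n t x - G x))
                atTop (𝓝 0) := by
  refine ⟨1, 1 / 8, driftField 𝕂, controlField 𝕂, fun t : ℝ => (t : 𝕂), rfl, by norm_num, rfl, rfl,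
    rfl, memAnalytic_driftField, memAnalytic_controlField, by simp [driftField],
    (RCLike.ofRealCLM (K := 𝕂)).contDiff.contDiffOn, ?_⟩
  intro B hB _ had t ht
  refine ⟨fun n => memCinfty_of_contDiffOn ?_, ?_⟩
  · exact ContDiffOn.sum fun k _ => (contDiffOn_adField k).const_smul _
  · rintro δ' ⟨hδ0, hδ⟩ ⟨G, -, hG⟩
    set F := fun n : ℕ => magnusLinearSum B (driftField 𝕂) (controlField 𝕂)
      (fun t : ℝ => (t : 𝕂)) n t with hF
    -- At this point of the ball the denominators are 1 and `x_2` is as large as allowed.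
    set x : StateSpace 𝕂 2 := EuclideanSpace.single 1 (δ' : 𝕂) with hx
    have hx0 : x 0 = 0 := by simp [hx]
    have hx1 : x 1 = (δ' : 𝕂) := by simp [hx]
    have hxB : x ∈ Metric.closedBall 0 δ' := by simp [hx, abs_of_pos hδ0]
    have hxU : x ∈ regularSet 𝕂 := closedBall_subset_regularSet (by linarith) hxB
    have hlim : Tendsto (fun n => F n x 1) atTop (𝓝 (G x 1)) := by
      rw [tendsto_iff_edist_tendsto_0]
      refine tendsto_of_tendsto_of_tendsto_of_le_of_le tendsto_const_nhds hG (fun _ => zero_le)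
        fun n => ?_
      rw [edist_eq_enorm_sub]
      exact enorm_le_ckNorm_zero (f := fun y => F n y - G y) hxB 1
    -- Convergence forces consecutive partial sums to merge, so a single term tends to 0.
    have hdiff := ((hlim.comp (tendsto_add_atTop_nat 1)).sub hlim).norm
    rw [sub_self, norm_zero] at hdiff
    have hterm : ∀ n, ‖F (n + 1) x 1 - F n x 1‖ = t ^ (n + 1 + 2) *
        |((bernoulli' (n + 1 + 1) / ((n + 1 + 1).factorial : ℚ) : ℚ) : ℝ)| *
          ((n + 1).factorial * δ' ^ (n + 1)) := by
      intro n
      have e : F (n + 1) x = F n x + firstKindCoord B (affineInput fun t : ℝ => (t : 𝕂)) t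
          (adBracket (n + 1)) • adField (driftField 𝕂) (controlField 𝕂) (n + 1) x :=
        Finset.sum_range_succ _ _
      rw [e, PiLp.add_apply, add_sub_cancel_left, PiLp.smul_apply, smul_eq_mul,
        adField_apply_one _ hxU, NCSeries.firstKindCoord_adBracket hB had, hx0, hx1]
      have hq : ∀ q : ℚ, ‖(q : 𝕂)‖ = |(q : ℝ)| := fun q => by
        rw [← RCLike.ofReal_ratCast, RCLike.norm_ofReal]
      rw [norm_mul, norm_mul, hq]
      simp [abs_of_pos hδ0, abs_of_pos ht.1]
    refine not_tendsto_bernoulli'_mul_factorial ht.1 hδ0 ((tendsto_add_atTop_iff_nat 1).mp ?_)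
    exact hdiff.congr hterm
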